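/- Let $N,S,D\ge 1$ be integers and let $o\in\mathbb R^N$. Consider the $N$-qubit observable $O=\sum_{j=1}^N o_jZ_j$, where $Z_j$ is the Pauli operator $Z$ on the $j$-th qubit and the identity on the others, and write $\|O\|$ for its operator norm. Put $$\Delta_S:=\min_{g\in\{0,\pm1\}^N,\ 1\le\|g\|_1\le S}(g^To)^2 ,$$ and assume $\Delta_S>0$. Let $\mathcal Q$ be a non-empty set of $S$-element subsets of $\{1,\dots,N\}$. The circuit is $$V(\theta)=e^{-iH_D\theta_D/2}\cdots e^{-iH_1\theta_1/2},\qquad \theta\in\mathbb R^D,$$ where $H_d\in\{X,Y\}^{\otimes S}$ acts on the qubits of a group $\mathcal S_d\in\mathcal Q$ and trivially on the others. The pairs $(\mathcal S_d,H_d)$, $d=1,\dots,D$, are independent; each $H_d$ is uniformly distributed on $\{X,Y\}^{\otimes S}$ and independent of $\mathcal S_d$; and the groups are used uniformly, i.e. $\frac1D\sum_{d=1}^D\Pr[\mathcal S_d=q]=\frac1{|\mathcal Q|}$ for every $q\in\mathcal Q$ (for example, the $\mathcal S_d$ are i.i.d. uniform on $\mathcal Q$, or they are deterministic and each element of $\mathcal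 Q$ is used equally often). For each $a$ in a finite index set $\mathcal A$ let $x_a\in[-1,1]^N$, where all entries $x_{a,n}$ are i.i.d. uniform on $[-1,1]$ and independent of the gates, and let $\rho_a=|\psi(x_a)\rangle\langle\psi(x_a)|$ be the qubit embedding, with $$|\psi(x)\rangle=\bigotimes_{n=1}^N e^{-iZ\pi x_n/2}\,\frac{|0\rangle+|1\rangle}{\sqrt2}.$$ Let $z_a(\theta)=\mathrm{Tr}[O\,V(\theta)\rho_aV(\theta)^\dagger]$, let $J(\theta)\in\mathbb R^{D\times|\mathcal A|}$ be the Jacobian $J_{da}(\theta)=\partial z_a/\partial\theta_d(\theta)$, and let $K(\theta)=\frac1DJ(\theta)^TJ(\theta)$ be the quantum neural tangent kernel. Then there are absolute constants $C_1,C_2>0$ and $m_0\in\mathbb N$ such that, whenever $|\mathcal A|\ge m_0$, for all $N$, $S$, $D$, $o$ and $\mathcal Q$ as above and all $\delta,k\in(0,1)$: if $$D\ \ge\ D_0\ln\frac{D_0}{\delta},\quad D_0=C_2\,\frac{|\mathcal A|\,\|O\|^4}{k^2\Delta_S^2}\,\ln\frac{|\mathcal A|}{\delta},\qquad\text{and}\qquad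 S\ \ge\ 2+\log_2\frac{C_1^2|\mathcal A|^2\ln|\mathcal A|}{k^2|\mathcal Q|\delta^2},$$ then with probability at least $1-\delta$ every eigenvalue $\lambda$ of $K(0)$ satisfies $$(1-k)\frac{\Delta_S}{2^S}\ \le\ \lambda\ \le\ (1+k)\frac{\|O\|^2}{2^S}.$$ -/

import Mathlib

noncomputable section

namespace QNTK

/-- The Hilbert space of `N` qubits has the computational basis `Fin N → Fin 2`; this is the type
of operators on it. -/
abbrev QOp (N : ℕ) : Type := Matrix (Fin N → Fin 2) (Fin N → Fin 2) ℂ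

def pauliX : Matrix (Fin 2) (Fin 2) ℂ := !![0, 1; 1, 0]

def pauliY : Matrix (Fin 2) (Fin 2) ℂ := !![0, -Complex.I; Complex.I, 0]

def pauliZ : Matrix (Fin 2) (Fin 2) ℂ := !![1, 0; 0, -1]

/-- The two-letter alphabet `{X, Y}`. -/
def pauliXY : Fin 2 → Matrix (Fin 2) (Fin 2) ℂ := ![pauliX, pauliY]

/-- The tensor product `M 0 ⊗ M 1 ⊗ ⋯` of single-qubit operators. -/
def tensorOp {N : ℕ} (M : Fin N → Matrix (Fin 2) (Fin 2) ℂ) : QOp N :=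
  Matrix.of fun i j => ∏ n, M n (i n) (j n)

/-- The operator norm (largest singular value). -/
def opNorm {N : ℕ} (M : QOp N) : ℝ :=
  ‖Matrix.toEuclideanCLM (n := Fin N → Fin 2) (𝕜 := ℂ) M‖

/-- `Z` on the `k`-th qubit, the identity on the others. -/
def zOn {N : ℕ} (k : Fin N) : QOp N :=
  tensorOp fun n => if n = k then pauliZ else 1

/-- The observable `O = ∑ k, o k • Z_k`. -/
def observable {N : ℕ} (o : Fin N → ℝ) : QOp N :=
  ∑ k, (o k : ℂ) • zOn k

/-- A group of exactly `S` of the `N` qubits. -/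
def QubitGroup (N S : ℕ) : Type := {s : Finset (Fin N) // s.card = S}

instance (N S : ℕ) : DecidableEq (QubitGroup N S) :=
  inferInstanceAs (DecidableEq {s : Finset (Fin N) // s.card = S})

/-- The set of qubit groups is finite and carries the discrete σ-algebra. -/
instance (N S : ℕ) : MeasurableSpace (QubitGroup N S) := ⊤

/-- The Hamiltonian in `{X, Y}^{⊗ S}` with letters `w`, acting on the qubits of the group `s` (in
increasing order) and trivially on the other qubits. -/
def hamiltonian {N S : ℕ} (s : QubitGroup N S) (w : Fin S → Fin 2) : QOp N :=
  tensorOp fun n =>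
    if h : n ∈ s.1 then pauliXY (w ((s.1.orderIsoOfFin s.2).symm ⟨n, h⟩)) else 1

/-- The gate `exp(-i H t / 2)`. -/
def gate {N : ℕ} (H : QOp N) (t : ℝ) : QOp N :=
  NormedSpace.exp ((-(Complex.I * (t : ℂ) / 2)) • H)

/-- The circuit `V(θ) = exp(-i H_D θ_D / 2) ⋯ exp(-i H_1 θ_1 / 2)`: the first gate is the rightmost
factor. -/
def circuit {N D : ℕ} (H : Fin D → QOp N) (θ : Fin D → ℝ) : QOp N :=
  (List.ofFn fun d => gate (H d) (θ d)).reverse.prod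

/-- The qubit embedding `|ψ(x)⟩ = ⊗_n exp(-i Z π x_n / 2) (|0⟩ + |1⟩) / √2`. -/
def embeddingVec {N : ℕ} (x : Fin N → ℝ) : (Fin N → Fin 2) → ℂ := fun i =>
  ∏ n, Matrix.mulVec
    (NormedSpace.exp ((-(Complex.I * (Real.pi : ℂ) * (x n : ℂ) / 2)) • pauliZ))
    (fun _ => 1 / ((Real.sqrt 2 : ℝ) : ℂ)) (i n)

/-- The density matrix `|ψ(x)⟩⟨ψ(x)|`. -/
def embeddingState {N : ℕ} (x : Fin N → ℝ) : QOp N :=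
  Matrix.vecMulVec (embeddingVec x) (star (embeddingVec x))

/-- The prediction function `z(θ) = Tr[O V(θ) ρ V(θ)†]` (a real number for Hermitian `O`, `ρ`). -/
def prediction {N D : ℕ} (O : QOp N) (H : Fin D → QOp N) (ρ : QOp N) (θ : Fin D → ℝ) : ℝ :=
  (Matrix.trace (O * circuit H θ * ρ * (circuit H θ).conjTranspose)).re

/-- The Jacobian `J_{da}(θ) = ∂ z_a / ∂ θ_d (θ)`. -/
def jacobian {N D m : ℕ} (O : QOp N) (H : Fin D → QOp N) (ρ : Fin m → QOp N)
    (θ : Fin D → ℝ) : Matrix (Fin D) (Fin m) ℝ :=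
  Matrix.of fun d a => deriv (fun t => prediction O H (ρ a) (Function.update θ d t)) (θ d)

/-- The quantum neural tangent kernel `K(θ) = J(θ)ᵀ J(θ) / D`. -/
def qntk {N D m : ℕ} (O : QOp N) (H : Fin D → QOp N) (ρ : Fin m → QOp N)
    (θ : Fin D → ℝ) : Matrix (Fin m) (Fin m) ℝ :=
  (1 / (D : ℝ)) • ((jacobian O H ρ θ).transpose * jacobian O H ρ θ)

/-- `Δ_S`: the minimum of `(g ⬝ o)²` over `g ∈ {0, ±1}^N` with `1 ≤ ‖g‖₁ ≤ S` (a finite set,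
non-empty as soon as `1 ≤ S` and `1 ≤ N`). -/
def gapDelta {N : ℕ} (S : ℕ) (o : Fin N → ℝ) : ℝ :=
  sInf {r : ℝ | ∃ g : Fin N → ℤ, (∀ n, g n = 0 ∨ g n = 1 ∨ g n = -1) ∧
    1 ≤ ∑ n, |g n| ∧ ∑ n, |g n| ≤ (S : ℤ) ∧ r = (∑ n, (g n : ℝ) * o n) ^ 2}

/-- `D_0 = C₂ |𝒜| ‖O‖⁴ / (k² Δ_S²) · ln (|𝒜| / δ)` for a training set of size `m`. -/
def gateThreshold {N : ℕ} (C₂ : ℝ) (m S : ℕ) (o : Fin N → ℝ) (k δ : ℝ) : ℝ :=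
  C₂ * ((m : ℝ) * opNorm (observable o) ^ 4 / (k ^ 2 * gapDelta S o ^ 2)) *
    Real.log ((m : ℝ) / δ)

end QNTK

end

/-!
At the origin the Jacobian entry of a gate with group `s` and letters `w` at the input `y` is an
explicit trigonometric polynomial `F`, the `feature` of the gate (`jacobian_zero_eq_feature`): the
derivative of `∏ n ∈ s, f n (φ n)` in the direction `-o` at the angles `φ = π y`, where `f n` is
`cos` or `sin` according to the letter. So `K(0)` is the average over the gates of the matrices
`F(x_a) F(x_b)`.

Let `a_s` be the sum of `o k ^ 2` over the group `s`, the `groupWeight`. It lies between `Δ_S` and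
`‖O‖ ^ 2`, hence dividing the contribution of each gate by the weight of its group changes the
quadratic form of `K(0)` by a factor in `[Δ_S, ‖O‖ ^ 2]`. It suffices that the normalized kernel
is within `k * 2⁻ˢ` of `2⁻ˢ` times the identity (`eigenvalue_bounds_of_fluctuation_le`). That is
shown by Chebyshev's inequality in the Frobenius norm (`integral_fluctuation_le`):

* the sum of `F ^ 2` over the letters is `a_s` at every input, so the diagonal entries have mean
  exactly `2⁻ˢ`, and different gates are uncorrelated there;
* for two different inputs, the second moment over the gates is governed by the covariance of two
  features at one random input. It vanishes for different groups (`featureMoment_eq_zero`), and for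
  equal groups its square, summed over the letters of one gate, is at most `3 * 4⁻ˢ * a_s ^ 2`
  (`sum_featureMoment_sq_le`), because only pairings of the four differentiated qubits survive.

The resulting bound contains the terms `m / D`, `m ^ 2 * 4⁻ˢ / D` and `m ^ 2 * 8⁻ˢ / |Q|`. The last
is small by the assumption on `S`. For the first two to be small without a loss in `δ`, the number
of groups must be controlled by the ratio `r = ‖O‖ ^ 2 / Δ_S`: the gap makes the sums of `o` over
sets of qubits that differ in at most `S` places `√Δ_S`-separated, and counting them gives
`4 ^ S ≤ 16 r` and `2 ^ S * |Q| ≤ 64 r ^ 2` (`two_pow_and_card_le`). Together with the assumption on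
`S` this forces `r ≥ m / (2 k δ)`, and then `D ≥ 128 m r ^ 2 / k ^ 2` is enough.
-/

namespace QNTK

open Matrix MeasureTheory

/-! ### Tensor products of single-qubit operators -/

theorem sum_sum_prod_eq_prod_sum_sum {N : ℕ} (c : Fin N → Fin 2 → Fin 2 → ℂ) :
    ∑ i : Fin N → Fin 2, ∑ j : Fin N → Fin 2, ∏ n, c n (i n) (j n) =
      ∏ n, ∑ a, ∑ b, c n a b := by
  simp_rw [Fintype.prod_sum]

theorem tensorOp_mul {N : ℕ} (A B : Fin N → Matrix (Fin 2) (Fin 2) ℂ) :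
    tensorOp A * tensorOp B = tensorOp fun n => A n * B n := by
  ext i j
  simp only [tensorOp, Matrix.mul_apply, Matrix.of_apply, Fintype.prod_sum,
    ← Finset.prod_mul_distrib]

theorem tensorOp_isHermitian {N : ℕ} {A : Fin N → Matrix (Fin 2) (Fin 2) ℂ}
    (h : ∀ n, (A n).IsHermitian) : (tensorOp A).IsHermitian := by
  ext i j
  simp only [tensorOp, Matrix.conjTranspose_apply, Matrix.of_apply, star_prod]
  exact Finset.prod_congr rfl fun n _ => (h n).apply _ _

/-- The expectation of a tensor product of operators in a product state factorizes. -/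
theorem trace_tensorOp_mul_vecMulVec {N : ℕ} (A : Fin N → Matrix (Fin 2) (Fin 2) ℂ)
    (v : Fin N → Fin 2 → ℂ) :
    (tensorOp A * Matrix.vecMulVec (fun i : Fin N → Fin 2 => ∏ n, v n (i n))
      (star fun i : Fin N → Fin 2 => ∏ n, v n (i n))).trace =
      ∏ n, ∑ a, ∑ b, A n a b * v n b * star (v n a) := by
  rw [← sum_sum_prod_eq_prod_sum_sum]
  simp only [Matrix.trace, Matrix.diag_apply, Matrix.mul_apply, tensorOp, Matrix.of_apply,
    Matrix.vecMulVec_apply, Pi.star_apply, star_prod, Finset.prod_mul_distrib, mul_assoc]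

theorem pauliZ_isHermitian : pauliZ.IsHermitian := by
  ext i j; fin_cases i <;> fin_cases j <;> simp [pauliZ]

theorem observable_isHermitian {N : ℕ} (o : Fin N → ℝ) : (observable o).IsHermitian := by
  refine Matrix.IsHermitian.ext fun i j => ?_
  have h : ∀ k : Fin N, (zOn k).IsHermitian := fun k => tensorOp_isHermitian fun n => by
    split_ifs
    · exact pauliZ_isHermitian
    · exact Matrix.isHermitian_one
  simp only [observable, Matrix.sum_apply, Matrix.smul_apply, star_sum, smul_eq_mul, star_mul']
  refine Finset.sum_congr rfl fun k _ => ?_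
  rw [(h k).apply]
  simp

/-! ### The Jacobian at the origin -/

theorem gate_zero {N : ℕ} (H : QOp N) : gate H 0 = 1 := by
  simp [gate]

theorem prod_reverse_ofFn_eq {M : Type*} [Monoid M] :
    ∀ {D : ℕ} (f : Fin D → M) (d : Fin D), (∀ e, e ≠ d → f e = 1) →
      (List.ofFn f).reverse.prod = f d
  | 0, _, d, _ => d.elim0
  | D + 1, f, d, h => by
    rw [List.ofFn_succ, List.reverse_cons, List.prod_append, List.prod_singleton]
    rcases Fin.eq_zero_or_eq_succ d with rfl | ⟨d, rfl⟩
    · have : (List.ofFn fun i : Fin D => f i.succ) = List.replicate D 1 := by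
        rw [← List.ofFn_const]
        exact congrArg _ (funext fun i => h _ (Fin.succ_ne_zero i))
      simp [this]
    · rw [prod_reverse_ofFn_eq (fun i => f i.succ) d
        fun e he => h _ fun h' => he (Fin.succ_injective _ h'), h 0 (Fin.succ_ne_zero d).symm,
        mul_one]

theorem circuit_update_zero {N D : ℕ} (H : Fin D → QOp N) (d : Fin D) (t : ℝ) :
    circuit H (Function.update 0 d t) = gate (H d) t := by
  rw [circuit, prod_reverse_ofFn_eq _ d]
  · simp
  · intro e he
    simp [Function.update_of_ne he, gate_zero]

section Deriv

attribute [local instance] Matrix.linftyOpNormedAddCommGroup Matrix.linftyOpNormedRing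
  Matrix.linftyOpNormedAlgebra Matrix.linftyOpNormedSpace

theorem hasDerivAt_exp_smul_matrix {ι : Type*} [Fintype ι] [DecidableEq ι] (A : Matrix ι ι ℂ) :
    HasDerivAt (fun t : ℝ => NormedSpace.exp (t • A)) A 0 := by
  have h := hasDerivAt_exp_smul_const (𝕂 := ℝ) A 0
  rw [zero_smul, NormedSpace.exp_zero, one_mul] at h
  exact h

theorem hasDerivAt_re_trace_conj {ι : Type*} [Fintype ι] [DecidableEq ι] (O A ρ : Matrix ι ι ℂ) :
    HasDerivAt (fun t : ℝ => (Matrix.trace (O * NormedSpace.exp (t • A) * ρ *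
      (NormedSpace.exp (t • A)).conjTranspose)).re)
      (Matrix.trace (O * A * ρ) + Matrix.trace (O * ρ * A.conjTranspose)).re 0 := by
  have h1 := hasDerivAt_exp_smul_matrix A
  have h2 : HasDerivAt (fun t : ℝ => (NormedSpace.exp (t • A)).conjTranspose)
      A.conjTranspose 0 := by
    have := hasDerivAt_exp_smul_matrix A.conjTranspose
    refine this.congr_of_eventuallyEq (Filter.Eventually.of_forall fun t => ?_)
    simp only
    rw [← Matrix.exp_conjTranspose, Matrix.conjTranspose_smul]
    simp
  have h3 := ((h1.const_mul O).mul_const ρ).mul h2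
  let L : Matrix ι ι ℂ →ₗ[ℝ] ℝ := Complex.reLm ∘ₗ Matrix.traceLinearMap ι ℝ ℂ
  have h4 := (LinearMap.toContinuousLinearMap L).hasFDerivAt.comp_hasDerivAt (0 : ℝ) h3
  have e : L (O * A * ρ * (NormedSpace.exp ((0 : ℝ) • A)).conjTranspose +
      O * NormedSpace.exp ((0 : ℝ) • A) * ρ * A.conjTranspose) =
      (Matrix.trace (O * A * ρ) + Matrix.trace (O * ρ * A.conjTranspose)).re := by
    simp [L]
  rw [← e]
  exact h4

end Deriv

theorem jacobian_zero_apply {N D m : ℕ} (O : QOp N) (hO : O.IsHermitian) (H : Fin D → QOp N)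
 (ρ : Fin m → QOp N) (hρ : ∀ a, (ρ a).IsHermitian)
    (d : Fin D) (a : Fin m) :
    jacobian O H ρ 0 d a = (Matrix.trace (O * H d * ρ a)).im := by
  have h := hasDerivAt_re_trace_conj O ((-(Complex.I / 2)) • H d) (ρ a)
  have e : (fun t => prediction O H (ρ a) (Function.update 0 d t)) =
      fun t : ℝ => (Matrix.trace (O * NormedSpace.exp (t • ((-(Complex.I / 2)) • H d)) * ρ a *
      (NormedSpace.exp (t • ((-(Complex.I / 2)) • H d))).conjTranspose)).re := by
    ext t
    have : (-(Complex.I * (t : ℂ) / 2)) • H d = t • ((-(Complex.I / 2)) • H d) := by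
      rw [← smul_assoc, Complex.real_smul]
      congr 1
      ring
    rw [prediction, circuit_update_zero, gate, this]
  have h' : Matrix.trace (O * ρ a * ((-(Complex.I / 2)) • H d).conjTranspose) =
      star (Matrix.trace (O * ((-(Complex.I / 2)) • H d) * ρ a)) := by
    rw [← Matrix.trace_conjTranspose, Matrix.conjTranspose_mul, Matrix.conjTranspose_mul,
      hO.eq, (hρ a).eq, Matrix.mul_assoc, Matrix.trace_mul_comm, ← Matrix.mul_assoc,
      Matrix.mul_assoc (ρ a), Matrix.trace_mul_comm]
  rw [jacobian, Matrix.of_apply, e]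
  simp only [Pi.zero_apply]
  rw [h.deriv, h']
  simp only [Matrix.mul_smul, Matrix.smul_mul, Matrix.trace_smul, smul_eq_mul]
  generalize Matrix.trace (O * H d * ρ a) = z
  simp [Complex.mul_re]
  ring

/-! ### The feature map of a gate -/

/-- The letter that the gate `(s, w)` puts on qubit `n` (with value `0` off the group `s`). -/
def letter {N S : ℕ} (s : QubitGroup N S) (w : Fin S → Fin 2) (n : Fin N) : Fin 2 :=
  if h : n ∈ s.1 then w ((s.1.orderIsoOfFin s.2).symm ⟨n, h⟩) else 0

/-- For `b = false`, the expectation of the Pauli letter `c` (`0` for `X`, `1` for `Y`) in the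
single-qubit state with angle `π t`; for `b = true`, minus its derivative in the angle. -/
noncomputable def pauliMean (b : Bool) (c : Fin 2) (t : ℝ) : ℝ :=
  if b then (if c = 0 then Real.sin (Real.pi * t) else -Real.cos (Real.pi * t))
  else (if c = 0 then Real.cos (Real.pi * t) else Real.sin (Real.pi * t))

/-- The entry of the Jacobian at the origin that belongs to the gate with group `s` and letters
`w` and to the input `y`. -/
noncomputable def feature {N S : ℕ} (o : Fin N → ℝ) (s : QubitGroup N S) (w : Fin S → Fin 2)
    (y : Fin N → ℝ) : ℝ :=
  ∑ k ∈ s.1, o k * ∏ n ∈ s.1, pauliMean (decide (n = k)) (letter s w n) (y n)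

/-- The amplitudes of one qubit of the embedding. -/
noncomputable def qubitVec (t : ℝ) : Fin 2 → ℂ :=
  ![Complex.exp (-(Complex.I * Real.pi * t / 2)) / (Real.sqrt 2 : ℝ),
    Complex.exp (Complex.I * Real.pi * t / 2) / (Real.sqrt 2 : ℝ)]

theorem embeddingVec_eq {N : ℕ} (x : Fin N → ℝ) :
    embeddingVec x = fun i => ∏ n, qubitVec (x n) (i n) := by
  funext i
  refine Finset.prod_congr rfl fun n _ => ?_
  have hZ : pauliZ = Matrix.diagonal ![1, -1] := by
    ext i j; fin_cases i <;> fin_cases j <;> simp [pauliZ]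
  generalize i n = c
  rw [hZ, ← Matrix.diagonal_smul, Matrix.exp_diagonal]
  rw [Matrix.mulVec_diagonal]
  fin_cases c <;> simp [qubitVec, ← Complex.exp_eq_exp_ℂ, div_eq_mul_inv]

theorem embeddingState_eq {N : ℕ} (x : Fin N → ℝ) :
    embeddingState x = Matrix.vecMulVec (fun i => ∏ n, qubitVec (x n) (i n))
      (star fun i : Fin N → Fin 2 => ∏ n, qubitVec (x n) (i n)) := by
  rw [embeddingState, embeddingVec_eq]

theorem embeddingState_isHermitian {N : ℕ} (x : Fin N → ℝ) : (embeddingState x).IsHermitian := by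
  ext i j
  simp [embeddingState, Matrix.vecMulVec_apply, mul_comm]

/-- The expectation of a single-qubit operator `A` in the state with amplitudes `qubitVec t`. -/
noncomputable def qubitMean (A : Matrix (Fin 2) (Fin 2) ℂ) (t : ℝ) : ℂ :=
  ∑ a, ∑ b, A a b * qubitVec t b * star (qubitVec t a)

theorem qubitMean_eq (A : Matrix (Fin 2) (Fin 2) ℂ) (t : ℝ) :
    qubitMean A t = (A 0 0 + A 1 1) / 2 + A 0 1 * Complex.exp (Complex.I * Real.pi * t) / 2 +
      A 1 0 * Complex.exp (-(Complex.I * Real.pi * t)) / 2 := by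
  have h2 : ((Real.sqrt 2 : ℝ) : ℂ) * ((Real.sqrt 2 : ℝ) : ℂ) = 2 := by
    rw [← Complex.ofReal_mul, Real.mul_self_sqrt (by norm_num)]; norm_num
  have h0 : ((Real.sqrt 2 : ℝ) : ℂ) ≠ 0 := fun h => by rw [h] at h2; norm_num at h2
  have c1 : (starRingEnd ℂ) (Complex.exp (Complex.I * Real.pi * t / 2)) =
      Complex.exp (-(Complex.I * Real.pi * t / 2)) := by
    rw [← Complex.exp_conj]; congr 1; simp [neg_div, Complex.conj_ofNat]
  have c2 : (starRingEnd ℂ) (Complex.exp (-(Complex.I * Real.pi * t / 2))) =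
      Complex.exp (Complex.I * Real.pi * t / 2) := by
    rw [← Complex.exp_conj]; congr 1; simp [neg_div, Complex.conj_ofNat]
  have e1 : Complex.exp (Complex.I * Real.pi * t) =
      Complex.exp (Complex.I * Real.pi * t / 2) * Complex.exp (Complex.I * Real.pi * t / 2) := by
    rw [← Complex.exp_add]; ring_nf
  have e2 : Complex.exp (-(Complex.I * Real.pi * t)) =
      Complex.exp (-(Complex.I * Real.pi * t / 2)) *
        Complex.exp (-(Complex.I * Real.pi * t / 2)) := by
    rw [← Complex.exp_add]; ring_nf
  have e3 : Complex.exp (Complex.I * Real.pi * t / 2) *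
      Complex.exp (-(Complex.I * Real.pi * t / 2)) = 1 := by
    rw [← Complex.exp_add]; simp
  simp only [qubitMean, Fin.sum_univ_two, qubitVec, Matrix.cons_val_zero, Matrix.cons_val_one,
    Complex.star_def, map_div₀, c1, c2, Complex.conj_ofReal, e1, e2]
  set u := Complex.exp (Complex.I * Real.pi * t / 2)
  set v := Complex.exp (-(Complex.I * Real.pi * t / 2))
  field_simp
  linear_combination (A 0 0 + A 1 1) * 2 * e3 -
    (u ^ 2 * A 0 1 + A 0 0 + v ^ 2 * A 1 0 + A 1 1) * h2

theorem exp_I_mul_pi (t : ℝ) : Complex.exp (Complex.I * Real.pi * t) =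
    (Real.cos (Real.pi * t) : ℂ) + (Real.sin (Real.pi * t) : ℂ) * Complex.I := by
  rw [mul_assoc, mul_comm, Complex.exp_mul_I]; push_cast; rfl

theorem exp_neg_I_mul_pi (t : ℝ) : Complex.exp (-(Complex.I * Real.pi * t)) =
    (Real.cos (Real.pi * t) : ℂ) - (Real.sin (Real.pi * t) : ℂ) * Complex.I := by
  rw [mul_assoc, mul_comm, ← neg_mul, Complex.exp_mul_I, Complex.cos_neg, Complex.sin_neg]
  push_cast; ring

theorem qubitMean_pauliXY (c : Fin 2) (t : ℝ) :
    qubitMean (pauliXY c) t = (pauliMean false c t : ℂ) := by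
  rw [qubitMean_eq, exp_I_mul_pi, exp_neg_I_mul_pi]
  fin_cases c
  · simp [pauliXY, pauliX, pauliMean]; ring
  · simp [pauliXY, pauliY, pauliMean]
    linear_combination (-Complex.sin (Real.pi * t)) * Complex.I_mul_I

theorem qubitMean_pauliZ_mul_pauliXY (c : Fin 2) (t : ℝ) :
    qubitMean (pauliZ * pauliXY c) t = Complex.I * (pauliMean true c t : ℂ) := by
  rw [qubitMean_eq, exp_I_mul_pi, exp_neg_I_mul_pi]
  fin_cases c
  · simp [pauliXY, pauliX, pauliZ, pauliMean]; ring
  · simp [pauliXY, pauliY, pauliZ, pauliMean]; ring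

theorem qubitMean_one (t : ℝ) : qubitMean 1 t = 1 := by
  rw [qubitMean_eq]; norm_num

theorem qubitMean_pauliZ (t : ℝ) : qubitMean pauliZ t = 0 := by
  rw [qubitMean_eq]; norm_num [pauliZ]

/-- Only the terms `Z_k` of the observable with `k` in the group contribute to the Jacobian: off
the group, the factor at `k` is the expectation of `Z`, which vanishes. -/
theorem im_trace_zOn_mul_hamiltonian {N S : ℕ} (k : Fin N) (s : QubitGroup N S)
    (w : Fin S → Fin 2) (y : Fin N → ℝ) :
    (Matrix.trace (zOn k * hamiltonian s w * embeddingState y)).im =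
      if k ∈ s.1 then ∏ n ∈ s.1, pauliMean (decide (n = k)) (letter s w n) (y n) else 0 := by
  rw [zOn, hamiltonian, tensorOp_mul, embeddingState_eq, trace_tensorOp_mul_vecMulVec]
  change (∏ n, qubitMean _ (y n)).im = _
  split_ifs with hk
  · have h : ∀ n, qubitMean ((if n = k then pauliZ else 1) *
        (if h : n ∈ s.1 then pauliXY (w ((s.1.orderIsoOfFin s.2).symm ⟨n, h⟩)) else 1)) (y n) =
        (if n = k then Complex.I else 1) *
          (((if n ∈ s.1 then pauliMean (decide (n = k)) (letter s w n) (y n) else 1) : ℝ) : ℂ) := by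
      intro n
      by_cases hn : n ∈ s.1
      · by_cases hnk : n = k
        · simp only [hnk, if_true, dif_pos, hk, qubitMean_pauliZ_mul_pauliXY, letter,
            decide_true]
        · simp only [hn, hnk, if_true, if_false, dif_pos, qubitMean_pauliXY, letter, one_mul,
            decide_false]
      · have hnk : n ≠ k := fun e => hn (e ▸ hk)
        simp [hn, hnk, qubitMean_one]
    rw [Finset.prod_congr rfl fun n _ => h n, Finset.prod_mul_distrib,
      Finset.prod_ite_eq' Finset.univ k, if_pos (Finset.mem_univ k), ← Complex.ofReal_prod,
      Finset.prod_ite_mem, Finset.univ_inter, Complex.I_mul_im, Complex.ofReal_re]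
  · rw [Finset.prod_eq_zero (Finset.mem_univ k)]
    · simp
    · simp [hk, qubitMean_pauliZ]

theorem jacobian_zero_eq_feature {N S D m : ℕ} (o : Fin N → ℝ) (s : Fin D → QubitGroup N S)
    (w : Fin D → Fin S → Fin 2) (x : Fin m → Fin N → ℝ) (d : Fin D) (a : Fin m) :
    jacobian (observable o) (fun d => hamiltonian (s d) (w d)) (fun a => embeddingState (x a)) 0
      d a = feature o (s d) (w d) (x a) := by
  rw [jacobian_zero_apply _ (observable_isHermitian o) _
    _ (fun a => embeddingState_isHermitian _)]
  simp only [observable, Finset.sum_mul, Matrix.trace_sum, Complex.im_sum, Matrix.smul_mul,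
    Matrix.trace_smul, smul_eq_mul, Complex.im_ofReal_mul,
    im_trace_zOn_mul_hamiltonian, feature, mul_ite, mul_zero]
  rw [Finset.sum_ite_mem, Finset.univ_inter]

/-! ### The gap of the observable and the number of qubit groups -/

theorem zOn_apply {N : ℕ} (k : Fin N) (i j : Fin N → Fin 2) :
    zOn k i j = if i = j then (if j k = 0 then 1 else -1) else 0 := by
  rw [zOn, tensorOp, Matrix.of_apply]
  split_ifs with hij hk
  · subst hij
    refine Finset.prod_eq_one fun n _ => ?_
    split_ifs with hn
    · subst hn; simp [hk, pauliZ]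
    · simp
  · subst hij
    rw [Finset.prod_eq_single k]
    · have : i k = 1 := by omega
      simp [this, pauliZ]
    · intro n _ hn; simp [hn]
    · simp
  · obtain ⟨n, hn⟩ := Function.ne_iff.mp hij
    refine Finset.prod_eq_zero (Finset.mem_univ n) ?_
    split_ifs with h
    · rcases (show i n = 0 ∨ i n = 1 by omega) with h0 | h0 <;>
        rcases (show j n = 0 ∨ j n = 1 by omega) with h1 | h1 <;>
        simp_all [pauliZ]
    · simp [hn]

/-- The computational basis vector whose bits are the signs of `o` is an eigenvector of the
observable with eigenvalue `∑ |o k|`. -/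
theorem sum_abs_le_opNorm {N : ℕ} (o : Fin N → ℝ) : ∑ k, |o k| ≤ opNorm (observable o) := by
  let b : Fin N → Fin 2 := fun k => if 0 ≤ o k then 0 else 1
  let v : EuclideanSpace ℂ (Fin N → Fin 2) := EuclideanSpace.single b 1
  have hv : ‖v‖ = 1 := by simp [v]
  have h := (Matrix.toEuclideanCLM (n := Fin N → Fin 2) (𝕜 := ℂ) (observable o)).le_opNorm v
  have e : Matrix.toEuclideanCLM (n := Fin N → Fin 2) (𝕜 := ℂ) (observable o) v =
      ((∑ k, |o k| : ℝ) : ℂ) • v := by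
    ext i
    simp only [v, Matrix.ofLp_toEuclideanCLM, PiLp.ofLp_single,
      Matrix.mulVec_single_one, Matrix.col_apply, observable, Matrix.sum_apply,
      Matrix.smul_apply, smul_eq_mul, zOn_apply, PiLp.smul_apply, Pi.single_apply]
    split_ifs with hi
    · rw [mul_one, Complex.ofReal_sum]
      refine Finset.sum_congr rfl fun k _ => ?_
      by_cases hk : 0 ≤ o k
      · simp [b, hk, abs_of_nonneg hk]
      · simp [b, hk, abs_of_neg (not_le.mp hk)]
    · simp
  rw [e, norm_smul, hv, mul_one, mul_one, Complex.norm_real, Real.norm_eq_abs,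
    abs_of_nonneg (Finset.sum_nonneg fun k _ => abs_nonneg _)] at h
  exact h

theorem gapDelta_le {N S : ℕ} (o : Fin N → ℝ) (g : Fin N → ℤ)
    (hg : ∀ n, g n = 0 ∨ g n = 1 ∨ g n = -1) (h1 : 1 ≤ ∑ n, |g n|)
    (hS : ∑ n, |g n| ≤ (S : ℤ)) : gapDelta S o ≤ (∑ n, (g n : ℝ) * o n) ^ 2 := by
  refine csInf_le ⟨0, ?_⟩ ⟨g, hg, h1, hS, rfl⟩
  rintro r ⟨g, -, -, -, rfl⟩
  positivity

/-- Both `N` and `S` are positive when the gap is: otherwise the gap is the infimum of the empty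
set, which is `0`. -/
theorem one_le_of_gapDelta_pos {N S : ℕ} {o : Fin N → ℝ} (h : 0 < gapDelta S o) :
    1 ≤ S ∧ 1 ≤ N := by
  by_contra hc
  have : gapDelta S o = 0 := by
    rw [gapDelta, ← Real.sInf_empty]
    congr 1
    refine Set.eq_empty_of_forall_notMem ?_
    rintro r ⟨g, -, h1, h2, -⟩
    have hS : 1 ≤ S := by exact_mod_cast h1.trans h2
    have hN : N = 0 := by omega
    subst hN
    simp at h1
  exact h.ne' this

/-- Sums of `o` over two subsets of the qubits that differ in at most `S` places are separated. -/
theorem gapDelta_le_sq_sum_sub_sum {N S : ℕ} (o : Fin N → ℝ) {A B : Finset (Fin N)} (hAB : A ≠ B)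
    (hc : (A \ B).card + (B \ A).card ≤ S) :
    gapDelta S o ≤ (∑ n ∈ A, o n - ∑ n ∈ B, o n) ^ 2 := by
  let g : Fin N → ℤ := fun n => (if n ∈ A then 1 else 0) - (if n ∈ B then 1 else 0)
  have habs : ∑ n, |g n| = ((A \ B).card + (B \ A).card : ℕ) := by
    have : ∀ n, |g n| = (if n ∈ A \ B then 1 else 0) + (if n ∈ B \ A then 1 else 0) := by
      intro n
      by_cases hA : n ∈ A <;> by_cases hB : n ∈ B <;> simp [g, hA, hB]
    rw [Finset.sum_congr rfl fun n _ => this n, Finset.sum_add_distrib,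
      Finset.sum_boole, Finset.sum_boole, Finset.filter_univ_mem, Finset.filter_univ_mem]
    push_cast
    rfl
  have hpos : 1 ≤ (A \ B).card + (B \ A).card := by
    by_contra h
    have h1 : (A \ B).card = 0 := by omega
    have h2 : (B \ A).card = 0 := by omega
    rw [Finset.card_eq_zero, Finset.sdiff_eq_empty_iff_subset] at h1 h2
    exact hAB (Finset.Subset.antisymm h1 h2)
  have h := gapDelta_le (S := S) o g ?_ ?_ ?_
  · convert h using 2
    simp [g, sub_mul, Finset.sum_sub_distrib, ite_mul]
  · intro n
    by_cases hA : n ∈ A <;> by_cases hB : n ∈ B <;> simp [g, hA, hB]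
  · rw [habs]; exact_mod_cast hpos
  · rw [habs]; exact_mod_cast hc

theorem gapDelta_le_sq {N S : ℕ} (o : Fin N → ℝ) (hS : 1 ≤ S) (n : Fin N) :
    gapDelta S o ≤ o n ^ 2 := by
  have := gapDelta_le_sq_sum_sub_sum (S := S) o (A := {n}) (B := ∅) (by simp) (by simpa using hS)
  simpa using this

/-- The sum of the squared coefficients of the observable over a qubit group. -/
noncomputable def groupWeight {N S : ℕ} (o : Fin N → ℝ) (s : QubitGroup N S) : ℝ :=
  ∑ k ∈ s.1, o k ^ 2

theorem gapDelta_le_groupWeight {N S : ℕ} (o : Fin N → ℝ) (hS : 1 ≤ S) (s : QubitGroup N S) :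
    gapDelta S o ≤ groupWeight o s := by
  obtain ⟨n, hn⟩ : s.1.Nonempty := by rw [← Finset.card_pos, s.2]; omega
  exact (gapDelta_le_sq o hS n).trans
    (Finset.single_le_sum (f := fun k => o k ^ 2) (fun k _ => sq_nonneg _) hn)

theorem groupWeight_le_opNorm_sq {N S : ℕ} (o : Fin N → ℝ) (s : QubitGroup N S) :
    groupWeight o s ≤ opNorm (observable o) ^ 2 := by
  have h0 : 0 ≤ ∑ k, |o k| := Finset.sum_nonneg fun k _ => abs_nonneg _
  calc groupWeight o s ≤ ∑ k, |o k| ^ 2 := by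
        simp only [sq_abs]
        exact Finset.sum_le_univ_sum_of_nonneg fun k => sq_nonneg _
    _ ≤ (∑ k, |o k|) ^ 2 := Finset.sum_sq_le_sq_sum_of_nonneg fun k _ => abs_nonneg _
    _ ≤ _ := pow_le_pow_left₀ h0 (sum_abs_le_opNorm o) 2

/-- The number of members of a family of sets, any two of which differ in at most `S` places, is
bounded through the norm and the gap: the sums of `o` over them lie `√Δ` apart in an interval of
length `2 ‖O‖`. -/
theorem card_le_of_pairwise_card_le {N S : ℕ} {o : Fin N → ℝ} (hΔ : 0 < gapDelta S o)
    (hρ : 1 ≤ opNorm (observable o) / √(gapDelta S o)) (F : Finset (Finset (Fin N)))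
    (hF : ∀ A ∈ F, ∀ B ∈ F, (A \ B).card + (B \ A).card ≤ S) :
    (F.card : ℝ) ≤ 4 * (opNorm (observable o) / √(gapDelta S o)) := by
  set ρ := opNorm (observable o) / √(gapDelta S o) with hρ_def
  have hs : 0 < √(gapDelta S o) := Real.sqrt_pos.mpr hΔ
  have hmaps : ∀ A ∈ F, ⌊(∑ n ∈ A, o n) / √(gapDelta S o)⌋ ∈ Finset.Icc ⌊-ρ⌋ ⌊ρ⌋ := by
    intro A _
    have h : |∑ n ∈ A, o n| ≤ opNorm (observable o) :=
      (Finset.abs_sum_le_sum_abs _ _).trans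
        ((Finset.sum_le_univ_sum_of_nonneg fun k => abs_nonneg _).trans (sum_abs_le_opNorm o))
    rw [abs_le] at h
    rw [Finset.mem_Icc]
    constructor
    · refine Int.floor_le_floor ?_
      rw [hρ_def, ← neg_div]
      exact div_le_div_of_nonneg_right h.1 hs.le
    · exact Int.floor_le_floor (div_le_div_of_nonneg_right h.2 hs.le)
  have hinj : Set.InjOn (fun A : Finset (Fin N) => ⌊(∑ n ∈ A, o n) / √(gapDelta S o)⌋) F := by
    intro A hA B hB hfl
    by_contra hAB
    have h1 := gapDelta_le_sq_sum_sub_sum (S := S) o hAB (hF A hA B hB)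
    have h2 := Int.abs_sub_lt_one_of_floor_eq_floor hfl
    rw [← sub_div, abs_div, abs_of_pos hs, div_lt_one hs] at h2
    have h3 := pow_lt_pow_left₀ h2 (abs_nonneg _) two_ne_zero
    rw [sq_abs, Real.sq_sqrt hΔ.le] at h3
    linarith
  have hcard := Finset.card_le_card_of_injOn _ hmaps hinj
  rw [Int.card_Icc] at hcard
  have hle : ⌊-ρ⌋ ≤ ⌊ρ⌋ := Int.floor_le_floor (by linarith)
  have h1 : ((⌊ρ⌋ + 1 - ⌊-ρ⌋).toNat : ℝ) = (⌊ρ⌋ : ℝ) + 1 - (⌊-ρ⌋ : ℝ) := by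
    have : ((⌊ρ⌋ + 1 - ⌊-ρ⌋).toNat : ℤ) = ⌊ρ⌋ + 1 - ⌊-ρ⌋ := Int.toNat_of_nonneg (by omega)
    exact_mod_cast congrArg (Int.cast : ℤ → ℝ) this
  have h2 : (F.card : ℝ) ≤ (⌊ρ⌋ : ℝ) + 1 - (⌊-ρ⌋ : ℝ) := by
    rw [← h1]; exact_mod_cast hcard
  have h3 := Int.floor_le ρ
  have h4 := Int.sub_one_lt_floor (-ρ)
  linarith

/-- A set of `S` elements splits into two sets of `S / 2` elements and at most one more element. -/
theorem choose_le_choose_half_sq_mul {N S : ℕ} (hN : 1 ≤ N) :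
    N.choose S ≤ N.choose (S / 2) * N.choose (S / 2) * N := by
  set t := S / 2 with ht
  have h1 : N.choose S ≤ N.choose t * (N - t).choose (S - t) := by
    rw [← Nat.choose_mul (Nat.div_le_self S 2)]
    exact Nat.le_mul_of_pos_right _ (Nat.choose_pos (by omega))
  have h2 : (N - t).choose (S - t) ≤ N.choose (S - t) := Nat.choose_le_choose _ (by omega)
  have h3 : N.choose (S - t) ≤ N.choose t * N := by
    rcases (show S - t = t ∨ S - t = t + 1 by omega) with h | h
    · rw [h]; exact Nat.le_mul_of_pos_right _ hN
    · rw [h]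
      calc N.choose (t + 1) ≤ N.choose (t + 1) * (t + 1) := Nat.le_mul_of_pos_right _ (by omega)
        _ = N.choose t * (N - t) := Nat.choose_succ_right_eq N t
        _ ≤ _ := Nat.mul_le_mul_left _ (by omega)
  calc N.choose S ≤ N.choose t * (N.choose t * N) := h1.trans (Nat.mul_le_mul_left _ (h2.trans h3))
    _ = _ := by ring

/-- The ratio `‖O‖² / Δ_S` controls both `4 ^ S` and the number of groups: subsets of one group,
and arbitrary sets of at most `S / 2` qubits, differ pairwise in at most `S` places. -/
theorem two_pow_and_card_le {N S : ℕ} {o : Fin N → ℝ} (hΔ : 0 < gapDelta S o)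
    (Q : Finset (QubitGroup N S)) (hQ : Q.Nonempty) :
    1 ≤ opNorm (observable o) ^ 2 / gapDelta S o ∧
    (4 : ℝ) ^ S ≤ 16 * (opNorm (observable o) ^ 2 / gapDelta S o) ∧
    (2 : ℝ) ^ S * Q.card ≤ 64 * (opNorm (observable o) ^ 2 / gapDelta S o) ^ 2 := by
  obtain ⟨hS, hN⟩ := one_le_of_gapDelta_pos hΔ
  obtain ⟨q, -⟩ := hQ
  have hSN : S ≤ N := by
    have := Finset.card_le_univ q.1
    rwa [q.2, Fintype.card_fin] at this
  have hs : 0 < √(gapDelta S o) := Real.sqrt_pos.mpr hΔ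
  have hr : opNorm (observable o) ^ 2 / gapDelta S o =
      (opNorm (observable o) / √(gapDelta S o)) ^ 2 := by
    rw [div_pow, Real.sq_sqrt hΔ.le]
  have hNρ : (N : ℝ) ≤ opNorm (observable o) / √(gapDelta S o) := by
    rw [le_div_iff₀ hs]
    refine le_trans ?_ (sum_abs_le_opNorm o)
    calc (N : ℝ) * √(gapDelta S o) = ∑ _k : Fin N, √(gapDelta S o) := by simp
      _ ≤ _ := Finset.sum_le_sum fun k _ =>
        Real.sqrt_le_iff.mpr ⟨abs_nonneg _, by rw [sq_abs]; exact gapDelta_le_sq o hS k⟩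
  have hρ : 1 ≤ opNorm (observable o) / √(gapDelta S o) :=
    le_trans (by exact_mod_cast hN) hNρ
  have h2S := card_le_of_pairwise_card_le hΔ hρ q.1.powerset (by
    intro A hA B hB
    rw [Finset.mem_powerset] at hA hB
    rw [← Finset.card_union_of_disjoint disjoint_sdiff_sdiff]
    refine (Finset.card_le_card ?_).trans_eq q.2
    exact Finset.union_subset (Finset.sdiff_subset.trans hA) (Finset.sdiff_subset.trans hB))
  have hch := card_le_of_pairwise_card_le hΔ hρ (Finset.univ.powersetCard (S / 2)) (by
    intro A hA B hB
    rw [Finset.mem_powersetCard] at hA hB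
    have h1 := Finset.card_le_card (Finset.sdiff_subset (s := A) (t := B))
    have h2 := Finset.card_le_card (Finset.sdiff_subset (s := B) (t := A))
    omega)
  rw [Finset.card_powerset, q.2] at h2S
  rw [Finset.card_powersetCard, Finset.card_univ, Fintype.card_fin] at hch
  push_cast at h2S
  have hQc : Q.card ≤ N.choose S := by
    have h := Finset.card_le_card_of_injOn (t := Finset.univ.powersetCard S)
      (fun q : QubitGroup N S => q.1)
      (fun q _ => Finset.mem_powersetCard.mpr ⟨Finset.subset_univ _, q.2⟩)
      (fun q _ q' _ h => Subtype.ext h : Set.InjOn _ (Q : Set (QubitGroup N S)))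
    rwa [Finset.card_powersetCard, Finset.card_univ, Fintype.card_fin] at h
  have hQc' : (Q.card : ℝ) ≤ N.choose (S / 2) * N.choose (S / 2) * N := by
    exact_mod_cast hQc.trans (choose_le_choose_half_sq_mul hN)
  rw [hr]
  set ρ := opNorm (observable o) / √(gapDelta S o)
  refine ⟨one_le_pow₀ hρ, ?_, ?_⟩
  · calc (4 : ℝ) ^ S = (2 ^ S) ^ 2 := by rw [← pow_mul, mul_comm, pow_mul]; norm_num
      _ ≤ (4 * ρ) ^ 2 := by gcongr
      _ = _ := by ring
  · have hρ0 : 0 ≤ ρ := by linarith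
    calc (2 : ℝ) ^ S * Q.card ≤ (4 * ρ) * ((4 * ρ) * (4 * ρ) * ρ) := by
          refine mul_le_mul h2S (hQc'.trans ?_) (by positivity) (by positivity)
          gcongr
      _ = _ := by ring

/-! ### Single-qubit moments -/

/-- The uniform distribution on `[-1, 1]`. -/
noncomputable abbrev unifMeasure : Measure ℝ := ProbabilityTheory.cond volume (Set.Icc (-1 : ℝ) 1)

instance : IsProbabilityMeasure unifMeasure :=
  ProbabilityTheory.cond_isProbabilityMeasure_of_finite (by simp) (by simp)

theorem integral_unifMeasure (f : ℝ → ℝ) :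
    ∫ t, f t ∂unifMeasure = (1 / 2) * ∫ t in (-1 : ℝ)..1, f t := by
  rw [unifMeasure, ProbabilityTheory.cond, integral_smul_measure, Real.volume_Icc,
    intervalIntegral.integral_of_le (by norm_num), integral_Icc_eq_integral_Ioc]
  norm_num [ENNReal.toReal_ofReal]

theorem integral_cos_sq_pi :
    ∫ t in (-1 : ℝ)..1, Real.cos (Real.pi * t) * Real.cos (Real.pi * t) = 1 := by
  rw [intervalIntegral.integral_comp_mul_left (fun t => Real.cos t * Real.cos t) Real.pi_ne_zero]
  simp only [← pow_two, integral_cos_sq]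
  simp

theorem integral_sin_sq_pi :
    ∫ t in (-1 : ℝ)..1, Real.sin (Real.pi * t) * Real.sin (Real.pi * t) = 1 := by
  rw [intervalIntegral.integral_comp_mul_left (fun t => Real.sin t * Real.sin t) Real.pi_ne_zero]
  simp only [← pow_two, integral_sin_sq]
  simp

theorem integral_sin_cos_pi :
    ∫ t in (-1 : ℝ)..1, Real.sin (Real.pi * t) * Real.cos (Real.pi * t) = 0 := by
  rw [intervalIntegral.integral_comp_mul_left (fun t => Real.sin t * Real.cos t) Real.pi_ne_zero]
  simp [integral_sin_mul_cos₁]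

theorem integral_cos_sin_pi :
    ∫ t in (-1 : ℝ)..1, Real.cos (Real.pi * t) * Real.sin (Real.pi * t) = 0 := by
  simpa only [mul_comm] using integral_sin_cos_pi

@[fun_prop]
theorem continuous_pauliMean (b : Bool) (c : Fin 2) : Continuous (pauliMean b c) := by
  unfold pauliMean
  split_ifs <;> fun_prop

theorem abs_pauliMean_le (b : Bool) (c : Fin 2) (t : ℝ) : |pauliMean b c t| ≤ 1 := by
  unfold pauliMean
  split_ifs <;> simp [Real.abs_cos_le_one, Real.abs_sin_le_one]

theorem sum_pauliMean_mul (b b' : Bool) (t : ℝ) :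
    ∑ c, pauliMean b c t * pauliMean b' c t = if b = b' then 1 else 0 := by
  have := Real.sin_sq_add_cos_sq (Real.pi * t)
  cases b <;> cases b' <;> simp [pauliMean] <;> linarith

theorem integral_pauliMean (b : Bool) (c : Fin 2) : ∫ t, pauliMean b c t ∂unifMeasure = 0 := by
  rw [integral_unifMeasure]
  cases b <;> fin_cases c <;> simp [pauliMean]

/-- The second moment of two single-qubit factors at a uniformly random input. -/
noncomputable def pauliMoment (b b' : Bool) (c c' : Fin 2) : ℝ :=
  ∫ t, pauliMean b c t * pauliMean b' c' t ∂unifMeasure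

theorem pauliMoment_self_letter (b b' : Bool) (c : Fin 2) :
    pauliMoment b b' c c = if b = b' then 1 / 2 else 0 := by
  rw [pauliMoment, integral_unifMeasure]
  cases b <;> cases b' <;> fin_cases c <;>
    simp [pauliMean, integral_cos_sq_pi, integral_sin_sq_pi, integral_sin_cos_pi,
      integral_cos_sin_pi]

/-- Whether a factor couples equal or opposite letters depends only on whether its two
derivative flags agree; different couplings are orthogonal. -/
theorem abs_sum_pauliMoment_mul_le (b b' β β' : Bool) (c : Fin 2) :
    |∑ c', pauliMoment b b' c c' * pauliMoment β β' c c'| ≤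
      if (b == b') = (β == β') then 1 / 4 else 0 := by
  simp only [pauliMoment, integral_unifMeasure, Fin.sum_univ_two]
  cases b <;> cases b' <;> cases β <;> cases β' <;> fin_cases c <;>
    norm_num [pauliMean, integral_cos_sq_pi, integral_sin_sq_pi, integral_sin_cos_pi,
      integral_cos_sin_pi]

/-! ### Second moments of the features -/

theorem prod_letter {N S : ℕ} (s : QubitGroup N S) (w : Fin S → Fin 2)
    (G : Fin N → Fin 2 → ℝ) :
    ∏ n ∈ s.1, G n (letter s w n) = ∏ i, G (s.1.orderIsoOfFin s.2 i) (w i) := by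
  rw [← Finset.prod_coe_sort, ← Equiv.prod_comp (s.1.orderIsoOfFin s.2).toEquiv]
  refine Finset.prod_congr rfl fun i _ => ?_
  have h : letter s w (s.1.orderIsoOfFin s.2 i) = w i := by
    rw [letter, dif_pos (s.1.orderIsoOfFin s.2 i).2]
    exact congrArg w ((s.1.orderIsoOfFin s.2).symm_apply_apply i)
  exact congrArg _ h

/-- Sums over the letters of a gate factorize over the qubits of its group. -/
theorem sum_prod_letter {N S : ℕ} (s : QubitGroup N S) (G : Fin N → Fin 2 → ℝ) :
    ∑ w : Fin S → Fin 2, ∏ n ∈ s.1, G n (letter s w n) = ∏ n ∈ s.1, ∑ c, G n c := by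
  simp_rw [prod_letter]
  rw [← Finset.prod_coe_sort, ← Equiv.prod_comp (s.1.orderIsoOfFin s.2).toEquiv]
  exact (Fintype.prod_sum fun (i : Fin S) c => G (s.1.orderIsoOfFin s.2 i) c).symm

theorem feature_mul_feature {N S : ℕ} (o : Fin N → ℝ) (s s' : QubitGroup N S)
    (w w' : Fin S → Fin 2) (y : Fin N → ℝ) :
    feature o s w y * feature o s' w' y = ∑ k ∈ s.1, ∑ l ∈ s'.1, o k * o l *
      ((∏ n ∈ s.1, pauliMean (decide (n = k)) (letter s w n) (y n)) *
        ∏ n ∈ s'.1, pauliMean (decide (n = l)) (letter s' w' n) (y n)) := by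
  rw [feature, feature, Finset.sum_mul_sum]
  refine Finset.sum_congr rfl fun k _ => Finset.sum_congr rfl fun l _ => by ring

theorem prod_ite_decide_eq {N : ℕ} (s : Finset (Fin N)) {k : Fin N} (hk : k ∈ s) (l : Fin N)
    (r : ℝ) : ∏ n ∈ s, (if decide (n = k) = decide (n = l) then r else 0) =
      if k = l then r ^ s.card else 0 := by
  split_ifs with h
  · subst h; simp
  · refine Finset.prod_eq_zero hk ?_
    simp [h]

/-- Averaged over the letters, the squared feature does not depend on the input: the cross terms
contain a factor `sin * cos - cos * sin`. -/
theorem sum_feature_sq {N S : ℕ} (o : Fin N → ℝ) (s : QubitGroup N S) (y : Fin N → ℝ) :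
    ∑ w, feature o s w y ^ 2 = groupWeight o s := by
  simp_rw [pow_two, feature_mul_feature, ← Finset.prod_mul_distrib]
  rw [Finset.sum_comm]
  refine Finset.sum_congr rfl fun k hk => ?_
  rw [Finset.sum_comm]
  have h : ∀ l ∈ s.1, ∑ w : Fin S → Fin 2, o k * o l * ∏ n ∈ s.1,
      (pauliMean (decide (n = k)) (letter s w n) (y n) *
        pauliMean (decide (n = l)) (letter s w n) (y n)) =
      o k * o l * if k = l then 1 else 0 := by
    intro l _
    rw [← Finset.mul_sum, sum_prod_letter s (fun n c => pauliMean (decide (n = k)) c (y n) *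
      pauliMean (decide (n = l)) c (y n))]
    simp_rw [sum_pauliMean_mul, prod_ite_decide_eq s.1 hk, one_pow]
  rw [Finset.sum_congr rfl h]
  simp [hk, pow_two]

theorem abs_feature_le {N S : ℕ} (o : Fin N → ℝ) (s : QubitGroup N S) (w : Fin S → Fin 2)
    (y : Fin N → ℝ) : |feature o s w y| ≤ ∑ k ∈ s.1, |o k| := by
  refine (Finset.abs_sum_le_sum_abs _ _).trans (Finset.sum_le_sum fun k _ => ?_)
  rw [abs_mul, Finset.abs_prod]
  exact mul_le_of_le_one_right (abs_nonneg _)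
    (Finset.prod_le_one (fun _ _ => abs_nonneg _) fun _ _ => abs_pauliMean_le _ _ _)

theorem feature_sq_le {N S : ℕ} (o : Fin N → ℝ) (s : QubitGroup N S) (w : Fin S → Fin 2)
    (y : Fin N → ℝ) : feature o s w y ^ 2 ≤ S * groupWeight o s := by
  rw [← sq_abs]
  refine (pow_le_pow_left₀ (abs_nonneg _) (abs_feature_le o s w y) 2).trans ?_
  have := sq_sum_le_card_mul_sum_sq (s := s.1) (f := fun k => |o k|)
  simpa [s.2, groupWeight] using this

@[fun_prop]
theorem continuous_feature {N S : ℕ} (o : Fin N → ℝ) (s : QubitGroup N S) (w : Fin S → Fin 2) :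
    Continuous (feature o s w) := by
  unfold feature
  fun_prop

/-- The distribution of one input vector. -/
noncomputable abbrev inputMeasure (N : ℕ) : Measure (Fin N → ℝ) :=
  Measure.pi fun _ => unifMeasure

/-- The second moment of the features of two gates at a random input. -/
noncomputable def featureMoment {N S : ℕ} (o : Fin N → ℝ) (s s' : QubitGroup N S)
    (w w' : Fin S → Fin 2) : ℝ :=
  ∫ y, feature o s w y * feature o s' w' y ∂inputMeasure N

theorem integrable_prod_pauliMean {N : ℕ} (s s' : Finset (Fin N)) (b b' : Fin N → Bool)
    (c c' : Fin N → Fin 2) :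
    Integrable (fun y : Fin N → ℝ => (∏ n ∈ s, pauliMean (b n) (c n) (y n)) *
      ∏ n ∈ s', pauliMean (b' n) (c' n) (y n)) (inputMeasure N) := by
  refine Integrable.of_bound (C := 1) (Continuous.aestronglyMeasurable (by fun_prop))
    (Filter.Eventually.of_forall fun y => ?_)
  rw [norm_mul, Real.norm_eq_abs, Real.norm_eq_abs, Finset.abs_prod, Finset.abs_prod]
  exact mul_le_one₀ (Finset.prod_le_one (fun _ _ => abs_nonneg _) fun _ _ => abs_pauliMean_le _ _ _)
    (Finset.prod_nonneg fun _ _ => abs_nonneg _)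
    (Finset.prod_le_one (fun _ _ => abs_nonneg _) fun _ _ => abs_pauliMean_le _ _ _)

theorem integral_prod_pauliMean {N : ℕ} (s s' : Finset (Fin N)) (b b' : Fin N → Bool)
    (c c' : Fin N → Fin 2) :
    ∫ y, (∏ n ∈ s, pauliMean (b n) (c n) (y n)) * ∏ n ∈ s', pauliMean (b' n) (c' n) (y n)
      ∂inputMeasure N = ∏ n, ∫ t, (if n ∈ s then pauliMean (b n) (c n) t else 1) *
        (if n ∈ s' then pauliMean (b' n) (c' n) t else 1) ∂unifMeasure := by
  rw [← integral_fintype_prod_eq_prod]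
  congr 1
  funext y
  rw [Finset.prod_mul_distrib]
  simp

theorem featureMoment_eq {N S : ℕ} (o : Fin N → ℝ) (s s' : QubitGroup N S)
    (w w' : Fin S → Fin 2) :
    featureMoment o s s' w w' = ∑ k ∈ s.1, ∑ l ∈ s'.1, o k * o l *
      ∏ n, ∫ t, (if n ∈ s.1 then pauliMean (decide (n = k)) (letter s w n) t else 1) *
        (if n ∈ s'.1 then pauliMean (decide (n = l)) (letter s' w' n) t else 1) ∂unifMeasure := by
  simp_rw [featureMoment, feature_mul_feature]
  rw [integral_finsetSum _ fun k _ => integrable_finsetSum _ fun l _ =>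
    (integrable_prod_pauliMean _ _ _ _ _ _).const_mul _]
  refine Finset.sum_congr rfl fun k _ => ?_
  rw [integral_finsetSum _ fun l _ => (integrable_prod_pauliMean _ _ _ _ _ _).const_mul _]
  refine Finset.sum_congr rfl fun l _ => ?_
  rw [integral_const_mul, integral_prod_pauliMean]

/-- Gates on different groups are uncorrelated: a qubit in one group only contributes a mean,
which vanishes. -/
theorem featureMoment_eq_zero {N S : ℕ} (o : Fin N → ℝ) {s s' : QubitGroup N S} (h : s ≠ s')
    (w w' : Fin S → Fin 2) : featureMoment o s s' w w' = 0 := by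
  obtain ⟨n, hn, hn'⟩ : ∃ n ∈ s.1, n ∉ s'.1 := by
    by_contra! hc
    exact h (Subtype.ext (Finset.eq_of_subset_of_card_le hc (by rw [s.2, s'.2])))
  rw [featureMoment_eq]
  refine Finset.sum_eq_zero fun k _ => Finset.sum_eq_zero fun l _ => ?_
  rw [Finset.prod_eq_zero (Finset.mem_univ n), mul_zero]
  simp [hn, hn', integral_pauliMean]

theorem featureMoment_same_group {N S : ℕ} (o : Fin N → ℝ) (s : QubitGroup N S)
    (w w' : Fin S → Fin 2) :
    featureMoment o s s w w' = ∑ k ∈ s.1, ∑ l ∈ s.1, o k * o l *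
      ∏ n ∈ s.1, pauliMoment (decide (n = k)) (decide (n = l)) (letter s w n) (letter s w' n) := by
  rw [featureMoment_eq]
  refine Finset.sum_congr rfl fun k _ => Finset.sum_congr rfl fun l _ => ?_
  rw [← Finset.prod_subset (Finset.subset_univ s.1)]
  · congr 1
    refine Finset.prod_congr rfl fun n hn => ?_
    simp [hn, pauliMoment]
  · intro n _ hn
    simp [hn]

theorem featureMoment_self {N S : ℕ} (o : Fin N → ℝ) (s : QubitGroup N S) (w : Fin S → Fin 2) :
    featureMoment o s s w w = (1 / 2) ^ S * groupWeight o s := by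
  rw [featureMoment_same_group, groupWeight, Finset.mul_sum]
  refine Finset.sum_congr rfl fun k hk => ?_
  simp_rw [pauliMoment_self_letter, prod_ite_decide_eq s.1 hk, s.2]
  simp [hk]
  ring

/-- Among four derivative positions, the couplings match at every qubit only if the positions
pair up. -/
theorem pairing_of_forall_beq {N : ℕ} {s : Finset (Fin N)} {k l k' l' : Fin N} (hk : k ∈ s)
    (hl : l ∈ s) (hk' : k' ∈ s)
    (h : ∀ n ∈ s, (decide (n = k) == decide (n = l)) = (decide (n = k') == decide (n = l'))) :
    (k = l ∧ k' = l') ∨ (k = k' ∧ l = l') ∨ (k = l' ∧ l = k') := by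
  have h1 := h k hk
  have h2 := h l hl
  have h3 := h k' hk'
  simp only [decide_true] at h1 h2 h3
  by_cases e1 : k = l <;> by_cases e2 : k' = l' <;> by_cases e3 : k = k' <;>
    by_cases e4 : l = l' <;> by_cases e5 : k = l' <;> by_cases e6 : l = k' <;> simp_all

theorem sum_pairing {N : ℕ} (s : Finset (Fin N)) (u : Fin N → ℝ) :
    ∑ k ∈ s, ∑ l ∈ s, ∑ k' ∈ s, ∑ l' ∈ s, u k * u l * (u k' * u l') *
      ((if k = l ∧ k' = l' then 1 else 0) + (if k = k' ∧ l = l' then 1 else 0) +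
        (if k = l' ∧ l = k' then 1 else 0)) = 3 * (∑ k ∈ s, u k ^ 2) ^ 2 := by
  have h : ∀ k ∈ s, ∑ l ∈ s, ∑ k' ∈ s, ∑ l' ∈ s, u k * u l * (u k' * u l') *
      ((if k = l ∧ k' = l' then 1 else 0) + (if k = k' ∧ l = l' then 1 else 0) +
        (if k = l' ∧ l = k' then 1 else 0)) = 3 * (u k ^ 2 * ∑ l ∈ s, u l ^ 2) := by
    intro k hk
    simp only [mul_add, Finset.sum_add_distrib, ite_and, mul_ite, mul_one, mul_zero,
      Finset.sum_ite_eq, Finset.sum_ite_irrel, Finset.sum_const_zero, hk, if_true]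
    simp only [← Finset.sum_filter, Finset.filter_mem_eq_inter, Finset.inter_self,
      Finset.mul_sum, ← Finset.sum_add_distrib]
    refine Finset.sum_congr rfl fun l _ => by ring
  rw [Finset.sum_congr rfl h, ← Finset.mul_sum, ← Finset.sum_mul]
  ring

/-- The fourth-moment bound behind the decay in the number of groups: of the four derivative
positions in `Γ(w, w')²`, summed over `w'`, only the three pairings survive. -/
theorem sum_featureMoment_sq_le {N S : ℕ} (o : Fin N → ℝ) (s : QubitGroup N S)
    (w : Fin S → Fin 2) :
    ∑ w', featureMoment o s s w w' ^ 2 ≤ 3 * (1 / 4) ^ S * groupWeight o s ^ 2 := by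
  have hT : ∀ k ∈ s.1, ∀ l ∈ s.1, ∀ k' ∈ s.1, ∀ l' ∈ s.1,
      |∏ n ∈ s.1, ∑ c', pauliMoment (decide (n = k)) (decide (n = l)) (letter s w n) c' *
        pauliMoment (decide (n = k')) (decide (n = l')) (letter s w n) c'| ≤
      (1 / 4) ^ S * ((if k = l ∧ k' = l' then 1 else 0) + (if k = k' ∧ l = l' then 1 else 0) +
        (if k = l' ∧ l = k' then 1 else 0)) := by
    intro k hk l hl k' hk' l' hl'
    rw [Finset.abs_prod]
    refine (Finset.prod_le_prod (fun _ _ => abs_nonneg _) fun n _ =>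
      abs_sum_pauliMoment_mul_le _ _ _ _ _).trans ?_
    by_cases h : ∀ n ∈ s.1,
        (decide (n = k) == decide (n = l)) = (decide (n = k') == decide (n = l'))
    · rw [Finset.prod_congr rfl fun n hn => if_pos (h n hn), Finset.prod_const, s.2]
      refine le_mul_of_one_le_right (by positivity) ?_
      have h0 : ∀ p : Prop, ∀ _ : Decidable p, (0 : ℝ) ≤ if p then 1 else 0 := by
        intro p _; split_ifs <;> norm_num
      have h1 := h0 (k = l ∧ k' = l') inferInstance
      have h2 := h0 (k = k' ∧ l = l') inferInstance
      have h3 := h0 (k = l' ∧ l = k') inferInstance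
      rcases pairing_of_forall_beq hk hl hk' h with e | e | e <;>
        rw [if_pos e] <;> linarith
    · push Not at h
      obtain ⟨n, hn, hne⟩ := h
      rw [Finset.prod_eq_zero hn (if_neg hne)]
      positivity
  have hexp : ∀ w', featureMoment o s s w w' ^ 2 = ∑ k ∈ s.1, ∑ l ∈ s.1, ∑ k' ∈ s.1, ∑ l' ∈ s.1,
      o k * o l * (o k' * o l') * ∏ n ∈ s.1,
        (pauliMoment (decide (n = k)) (decide (n = l)) (letter s w n) (letter s w' n) *
        pauliMoment (decide (n = k')) (decide (n = l')) (letter s w n) (letter s w' n)) := by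
    intro w'
    rw [pow_two, featureMoment_same_group]
    simp_rw [Finset.sum_mul, Finset.mul_sum, Finset.prod_mul_distrib]
    refine Finset.sum_congr rfl fun k _ => Finset.sum_congr rfl fun l _ =>
      Finset.sum_congr rfl fun k' _ => Finset.sum_congr rfl fun l' _ => by ring
  calc ∑ w', featureMoment o s s w w' ^ 2
      = ∑ k ∈ s.1, ∑ l ∈ s.1, ∑ k' ∈ s.1, ∑ l' ∈ s.1, o k * o l * (o k' * o l') *
        ∏ n ∈ s.1, ∑ c', pauliMoment (decide (n = k)) (decide (n = l)) (letter s w n) c' *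
          pauliMoment (decide (n = k')) (decide (n = l')) (letter s w n) c' := by
        simp_rw [hexp]
        rw [Finset.sum_comm]
        refine Finset.sum_congr rfl fun k _ => ?_
        rw [Finset.sum_comm]
        refine Finset.sum_congr rfl fun l _ => ?_
        rw [Finset.sum_comm]
        refine Finset.sum_congr rfl fun k' _ => ?_
        rw [Finset.sum_comm]
        refine Finset.sum_congr rfl fun l' _ => ?_
        rw [← Finset.mul_sum, sum_prod_letter s (fun n c' =>
          pauliMoment (decide (n = k)) (decide (n = l)) (letter s w n) c' *
          pauliMoment (decide (n = k')) (decide (n = l')) (letter s w n) c')]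
    _ ≤ ∑ k ∈ s.1, ∑ l ∈ s.1, ∑ k' ∈ s.1, ∑ l' ∈ s.1, |o k| * |o l| * (|o k'| * |o l'|) *
        ((1 / 4) ^ S * ((if k = l ∧ k' = l' then 1 else 0) +
          (if k = k' ∧ l = l' then 1 else 0) + (if k = l' ∧ l = k' then 1 else 0))) := by
        refine Finset.sum_le_sum fun k hk => Finset.sum_le_sum fun l hl =>
          Finset.sum_le_sum fun k' hk' => Finset.sum_le_sum fun l' hl' => ?_
        refine (le_abs_self _).trans ?_
        rw [abs_mul, abs_mul, abs_mul, abs_mul]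
        exact mul_le_mul_of_nonneg_left (hT k hk l hl k' hk' l' hl') (by positivity)
    _ = (1 / 4) ^ S * ∑ k ∈ s.1, ∑ l ∈ s.1, ∑ k' ∈ s.1, ∑ l' ∈ s.1,
        |o k| * |o l| * (|o k'| * |o l'|) * ((if k = l ∧ k' = l' then 1 else 0) +
          (if k = k' ∧ l = l' then 1 else 0) + (if k = l' ∧ l = k' then 1 else 0)) := by
        simp_rw [Finset.mul_sum]
        refine Finset.sum_congr rfl fun k _ => Finset.sum_congr rfl fun l _ =>
          Finset.sum_congr rfl fun k' _ => Finset.sum_congr rfl fun l' _ => by ring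
    _ = 3 * (1 / 4) ^ S * groupWeight o s ^ 2 := by
        rw [sum_pairing s.1 fun k => |o k|]
        simp only [sq_abs, groupWeight]
        ring

/-! ### Random gates and random inputs -/

instance (N S : ℕ) : Fintype (QubitGroup N S) :=
  inferInstanceAs (Fintype {s : Finset (Fin N) // s.card = S})

instance (N S : ℕ) : MeasurableSingletonClass (QubitGroup N S) := ⟨fun _ => trivial⟩

/-- The data of one gate: its qubit group and its letters. -/
abbrev Gate (N S : ℕ) : Type := QubitGroup N S × (Fin S → Fin 2)

/-- The contribution of one gate to the kernel, normalized by the weight of its group. -/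
noncomputable def gateKernel {N S : ℕ} (o : Fin N → ℝ) (g : Gate N S) (y y' : Fin N → ℝ) : ℝ :=
  feature o g.1 g.2 y * feature o g.1 g.2 y' / groupWeight o g.1

/-- What the argument uses of the randomness: the inputs have the uniform product law and are
pairwise independent, the gates are pairwise independent and independent of the inputs, and the
gate `d` has the group `q` with probability `p d q`, its letters being uniform. -/
structure IsCircuitSample {Ω : Type*} [MeasurableSpace Ω] (P : Measure Ω) {m N S D : ℕ}
    (X : Fin m → Ω → Fin N → ℝ) (g : Fin D → Ω → Gate N S)
    (p : Fin D → QubitGroup N S → ℝ) : Prop where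
  measurable_input : ∀ a, Measurable (X a)
  law_input : ∀ a, P.map (X a) = inputMeasure N
  indep_input : ∀ a b, a ≠ b → ProbabilityTheory.IndepFun (X a) (X b) P
  measurable_gate : ∀ d, Measurable (g d)
  indep_gate : ∀ d e, d ≠ e → ProbabilityTheory.IndepFun (g d) (g e) P
  indep : ProbabilityTheory.IndepFun (fun ω a => X a ω) (fun ω d => g d ω) P
  law_gate : ∀ d q u, P.real (g d ⁻¹' {(q, u)}) = p d q * (1 / 2) ^ S
  nonneg : ∀ d q, 0 ≤ p d q
  sum_eq_one : ∀ d, ∑ q, p d q = 1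

/-- Averaging over a finitely valued random variable that is independent of the rest. -/
theorem integral_comp_of_indepFun_fintype {Ω α β : Type*} [MeasurableSpace Ω] {P : Measure Ω}
    [IsProbabilityMeasure P] [MeasurableSpace α] [MeasurableSpace β] [Fintype β]
    [MeasurableSingletonClass β] {X : Ω → α} {Y : Ω → β} (hX : Measurable X) (hY : Measurable Y)
    (hXY : ProbabilityTheory.IndepFun X Y P) (f : α → β → ℝ) (hf : ∀ y, Measurable fun z => f z y)
    (C : ℝ) (hC : ∀ z y, |f z y| ≤ C) :
    ∫ ω, f (X ω) (Y ω) ∂P = ∑ y, P.real (Y ⁻¹' {y}) * ∫ ω, f (X ω) y ∂P := by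
  classical
  have hind : ∀ y : β, Measurable (Set.indicator ({y} : Set β) fun _ => (1 : ℝ)) := fun y =>
    measurable_const.indicator (measurableSet_singleton y)
  have h : ∀ ω, f (X ω) (Y ω) =
      ∑ y, Set.indicator ({y} : Set β) (fun _ => (1 : ℝ)) (Y ω) * f (X ω) y := by
    intro ω
    simp [Set.indicator_apply]
  simp_rw [h]
  rw [integral_finsetSum]
  · refine Finset.sum_congr rfl fun y _ => ?_
    rw [hXY.symm.integral_fun_comp_mul_comp (f := Set.indicator ({y} : Set β) fun _ => (1 : ℝ))
      (g := fun z => f z y) hY.aemeasurable hX.aemeasurable (hind y).aestronglyMeasurable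
      (hf y).aestronglyMeasurable]
    congr 1
    have : (fun ω => Set.indicator ({y} : Set β) (fun _ => (1 : ℝ)) (Y ω)) =
        Set.indicator (Y ⁻¹' {y}) 1 := by
      ext ω; simp [Set.indicator_apply]
    rw [this, integral_indicator_one (hY (measurableSet_singleton y))]
  · intro y _
    refine Integrable.of_bound (C := C)
      (((hind y).comp hY).mul ((hf y).comp hX)).aestronglyMeasurable
      (Filter.Eventually.of_forall fun ω => ?_)
    rw [norm_mul]
    refine (mul_le_of_le_one_left (norm_nonneg _) ?_).trans (hC (X ω) y)
    rw [Set.indicator_apply]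
    split_ifs <;> simp

section Kernel

variable {N S : ℕ} {o : Fin N → ℝ}

theorem sum_gateKernel_self (q : QubitGroup N S) (hq : 0 < groupWeight o q) (y : Fin N → ℝ) :
    ∑ u, gateKernel o (q, u) y y = 1 := by
  simp_rw [gateKernel, ← pow_two, ← Finset.sum_div, sum_feature_sq]
  exact div_self hq.ne'

theorem abs_gateKernel_le (g : Gate N S) (hg : 0 < groupWeight o g.1) (y y' : Fin N → ℝ) :
    |gateKernel o g y y'| ≤ S := by
  rw [gateKernel, abs_div, abs_of_pos hg, div_le_iff₀ hg, abs_mul]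
  have h1 := feature_sq_le o g.1 g.2 y
  have h2 := feature_sq_le o g.1 g.2 y'
  have h3 := two_mul_le_add_sq |feature o g.1 g.2 y| |feature o g.1 g.2 y'|
  rw [sq_abs, sq_abs] at h3
  linarith

theorem gateKernel_self_nonneg (g : Gate N S) (hg : 0 < groupWeight o g.1) (y : Fin N → ℝ) :
    0 ≤ gateKernel o g y y :=
  div_nonneg (mul_self_nonneg _) hg.le

@[fun_prop]
theorem continuous_gateKernel (g : Gate N S) :
    Continuous fun z : (Fin N → ℝ) × (Fin N → ℝ) => gateKernel o g z.1 z.2 := by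
  unfold gateKernel
  fun_prop

theorem measurable_gateKernel (g : Gate N S) {m : ℕ} (a b : Fin m) :
    Measurable fun z : Fin m → Fin N → ℝ => gateKernel o g (z a) (z b) :=
  ((continuous_gateKernel (o := o) g).comp
    (by fun_prop : Continuous fun z : Fin m → Fin N → ℝ => (z a, z b))).measurable

end Kernel

/-- The squared Frobenius distance of the normalized kernel from `2⁻ˢ` times the identity, which is
its mean. -/
noncomputable def fluctuation {N S m D : ℕ} (o : Fin N → ℝ)
    (g : Fin D → Gate N S) (X : Fin m → Fin N → ℝ) : ℝ :=
  ∑ a, ∑ b, ((1 / (D : ℝ)) * ∑ d, (gateKernel o (g d) (X a) (X b) -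
    if a = b then (1 / 2) ^ S else 0)) ^ 2

theorem fluctuation_eq {N S m D : ℕ} (o : Fin N → ℝ)
    (g : Fin D → Gate N S) (X : Fin m → Fin N → ℝ) :
    fluctuation o g X = ∑ a, ∑ b, (1 / (D : ℝ)) ^ 2 * ∑ d, ∑ e,
      (gateKernel o (g d) (X a) (X b) - if a = b then (1 / 2) ^ S else 0) *
      (gateKernel o (g e) (X a) (X b) - if a = b then (1 / 2) ^ S else 0) := by
  simp_rw [fluctuation, mul_pow, pow_two (∑ d, _), Finset.sum_mul_sum]

namespace IsCircuitSample

variable {Ω : Type*} [MeasurableSpace Ω] {P : Measure Ω} {m N S D : ℕ}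
  {X : Fin m → Ω → Fin N → ℝ} {g : Fin D → Ω → Gate N S} {p : Fin D → QubitGroup N S → ℝ}
  {o : Fin N → ℝ}

theorem measurable_inputs (h : IsCircuitSample P X g p) : Measurable fun ω a => X a ω :=
  measurable_pi_lambda _ h.measurable_input

theorem integral_comp_gate [IsProbabilityMeasure P]
    (h : IsCircuitSample P X g p) (d : Fin D)
    (f : (Fin m → Fin N → ℝ) → Gate N S → ℝ) (hf : ∀ y, Measurable fun z => f z y)
    (C : ℝ) (hC : ∀ z y, |f z y| ≤ C) :
    ∫ ω, f (fun a => X a ω) (g d ω) ∂P =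
      ∑ q, p d q * ((1 / 2) ^ S * ∑ u, ∫ ω, f (fun a => X a ω) (q, u) ∂P) := by
  have hi : ProbabilityTheory.IndepFun (fun ω a => X a ω) (g d) P :=
    h.indep.comp measurable_id (measurable_pi_apply d)
  rw [integral_comp_of_indepFun_fintype h.measurable_inputs (h.measurable_gate d) hi f hf C hC,
    Fintype.sum_prod_type]
  simp_rw [h.law_gate, Finset.mul_sum, mul_assoc]

theorem integral_comp_gate_gate [IsProbabilityMeasure P]
    (h : IsCircuitSample P X g p) {d e : Fin D} (hde : d ≠ e)
    (f : (Fin m → Fin N → ℝ) → Gate N S → Gate N S → ℝ)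
    (hf : ∀ y y', Measurable fun z => f z y y') (C : ℝ) (hC : ∀ z y y', |f z y y'| ≤ C) :
    ∫ ω, f (fun a => X a ω) (g d ω) (g e ω) ∂P =
      ∑ q, ∑ q', p d q * p e q' * ((1 / 4) ^ S *
        ∑ u, ∑ u', ∫ ω, f (fun a => X a ω) (q, u) (q', u') ∂P) := by
  have hi : ProbabilityTheory.IndepFun (fun ω a => X a ω) (fun ω => (g d ω, g e ω)) P :=
    h.indep.comp (φ := id) (ψ := fun v : Fin D → Gate N S => (v d, v e)) measurable_id
      ((measurable_pi_apply d).prodMk (measurable_pi_apply e))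
  have hlaw : ∀ y y', P.real ((fun ω => (g d ω, g e ω)) ⁻¹' {(y, y')}) =
      P.real (g d ⁻¹' {y}) * P.real (g e ⁻¹' {y'}) := by
    intro y y'
    have := (h.indep_gate d e hde).measure_inter_preimage_eq_mul {y} {y'}
      (measurableSet_singleton _) (measurableSet_singleton _)
    rw [measureReal_def, measureReal_def, measureReal_def, ← ENNReal.toReal_mul, ← this]
    congr 2
    ext ω; simp
  rw [integral_comp_of_indepFun_fintype h.measurable_inputs
    ((h.measurable_gate d).prodMk (h.measurable_gate e)) hi (fun z y => f z y.1 y.2)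
    (fun y => hf _ _) C (fun z y => hC _ _ _), Fintype.sum_prod_type]
  simp_rw [Fintype.sum_prod_type, hlaw, h.law_gate]
  refine Finset.sum_congr rfl fun q _ => ?_
  rw [Finset.sum_comm]
  refine Finset.sum_congr rfl fun q' _ => ?_
  simp_rw [Finset.mul_sum]
  refine Finset.sum_congr rfl fun u _ => Finset.sum_congr rfl fun u' _ => ?_
  have h4 : ((1 : ℝ) / 4) ^ S = (1 / 2) ^ S * (1 / 2) ^ S := by
    rw [← mul_pow]; norm_num
  rw [h4]
  ring

/-- At two different inputs, the product of the contributions of two fixed gates has the squared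
feature moment as its mean. -/
theorem integral_gateKernel_mul (h : IsCircuitSample P X g p) {a b : Fin m} (hab : a ≠ b)
    (y y' : Gate N S) :
    ∫ ω, gateKernel o y (X a ω) (X b ω) * gateKernel o y' (X a ω) (X b ω) ∂P =
      featureMoment o y.1 y'.1 y.2 y'.2 ^ 2 / (groupWeight o y.1 * groupWeight o y'.1) := by
  let F : (Fin N → ℝ) → ℝ := fun z => feature o y.1 y.2 z * feature o y'.1 y'.2 z
  have hF : Continuous F := by fun_prop
  have hm : ∀ c, ∫ ω, F (X c ω) ∂P = featureMoment o y.1 y'.1 y.2 y'.2 := by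
    intro c
    rw [featureMoment, ← h.law_input c, integral_map (h.measurable_input c).aemeasurable
      hF.aestronglyMeasurable]
  have e : ∀ ω, gateKernel o y (X a ω) (X b ω) * gateKernel o y' (X a ω) (X b ω) =
      F (X a ω) * F (X b ω) * (groupWeight o y.1 * groupWeight o y'.1)⁻¹ := by
    intro ω
    simp only [gateKernel, F, div_eq_mul_inv, mul_inv]
    ring
  simp_rw [e]
  rw [integral_mul_const, (h.indep_input a b hab).integral_fun_comp_mul_comp (f := F) (g := F)
    (h.measurable_input a).aemeasurable (h.measurable_input b).aemeasurable
    hF.aestronglyMeasurable hF.aestronglyMeasurable, hm, hm, pow_two, div_eq_mul_inv]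

theorem integrable_gateKernel_fixed [IsProbabilityMeasure P]
    (h : IsCircuitSample P X g p)
    (ho : ∀ q : QubitGroup N S, 0 < groupWeight o q) (y : Gate N S) (a b : Fin m) :
    Integrable (fun ω => gateKernel o y (X a ω) (X b ω)) P :=
  Integrable.of_bound (C := S)
    ((measurable_gateKernel y a b).comp h.measurable_inputs).aestronglyMeasurable
    (Filter.Eventually.of_forall fun _ => abs_gateKernel_le _ (ho _) _ _)

theorem measurable_comp_gate (h : IsCircuitSample P X g p) (d : Fin D)
    (F : (Fin m → Fin N → ℝ) → Gate N S → ℝ) (hF : ∀ y, Measurable fun z => F z y) :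
    Measurable fun ω => F (fun a => X a ω) (g d ω) := by
  have h1 : Measurable fun z : (Fin m → Fin N → ℝ) × Gate N S => F z.1 z.2 :=
    measurable_from_prod_countable_left
      (f := fun z : (Fin m → Fin N → ℝ) × Gate N S => F z.1 z.2) hF
  have h2 : Measurable fun ω => (fun a => X a ω, g d ω) :=
    h.measurable_inputs.prodMk (h.measurable_gate d)
  exact h1.comp h2

theorem measurable_gateKernel_gate (h : IsCircuitSample P X g p) (d : Fin D) (a b : Fin m) :
    Measurable fun ω => gateKernel o (g d ω) (X a ω) (X b ω) :=
  h.measurable_comp_gate d (fun z y => gateKernel o y (z a) (z b))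
    fun y => measurable_gateKernel y a b

theorem integral_gateKernel_self [IsProbabilityMeasure P]
    (h : IsCircuitSample P X g p)
    (ho : ∀ q : QubitGroup N S, 0 < groupWeight o q) (d : Fin D) (a : Fin m) :
    ∫ ω, gateKernel o (g d ω) (X a ω) (X a ω) ∂P = (1 / 2) ^ S := by
  rw [h.integral_comp_gate d (fun z y => gateKernel o y (z a) (z a))
    (fun y => measurable_gateKernel y a a) S (fun z y => abs_gateKernel_le _ (ho _) _ _)]
  have : ∀ q : QubitGroup N S, ∑ u, ∫ ω, gateKernel o (q, u) (X a ω) (X a ω) ∂P = 1 := by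
    intro q
    rw [← integral_finsetSum _ fun u _ => h.integrable_gateKernel_fixed ho _ a a]
    simp_rw [sum_gateKernel_self q (ho q)]
    simp
  simp_rw [this, mul_one, ← Finset.sum_mul, h.sum_eq_one, one_mul]

/-- The bound by `1` is crude: the fourth moment is at most `S * 2⁻ˢ`. -/
theorem integral_gateKernel_self_sq_le [IsProbabilityMeasure P]
    (h : IsCircuitSample P X g p)
    (ho : ∀ q : QubitGroup N S, 0 < groupWeight o q) (d : Fin D) (a : Fin m) :
    ∫ ω, gateKernel o (g d ω) (X a ω) (X a ω) * gateKernel o (g d ω) (X a ω) (X a ω) ∂P ≤ 1 := by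
  have hb : ∀ ω, |gateKernel o (g d ω) (X a ω) (X a ω)| ≤ S := fun ω =>
    abs_gateKernel_le _ (ho _) _ _
  have hm := (h.measurable_gateKernel_gate (o := o) d a a)
  have hi : Integrable (fun ω => gateKernel o (g d ω) (X a ω) (X a ω)) P :=
    Integrable.of_bound (C := S) hm.aestronglyMeasurable (Filter.Eventually.of_forall hb)
  calc _ ≤ ∫ ω, (S : ℝ) * gateKernel o (g d ω) (X a ω) (X a ω) ∂P := by
        refine integral_mono (hi.mul_bdd hm.aestronglyMeasurable
          (Filter.Eventually.of_forall hb)) (hi.const_mul _) fun ω => ?_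
        exact mul_le_mul_of_nonneg_right ((le_abs_self _).trans (hb ω))
          (gateKernel_self_nonneg _ (ho _) _)
    _ = S * (1 / 2) ^ S := by rw [integral_const_mul, h.integral_gateKernel_self ho]
    _ ≤ 1 := by
        rw [one_div, inv_pow, ← div_eq_mul_inv, div_le_one (by positivity)]
        exact_mod_cast Nat.lt_two_pow_self.le

theorem integral_gateKernel_sq [IsProbabilityMeasure P]
    (h : IsCircuitSample P X g p)
    (ho : ∀ q : QubitGroup N S, 0 < groupWeight o q) (d : Fin D) {a b : Fin m} (hab : a ≠ b) :
    ∫ ω, gateKernel o (g d ω) (X a ω) (X b ω) * gateKernel o (g d ω) (X a ω) (X b ω) ∂P =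
      (1 / 4) ^ S := by
  rw [h.integral_comp_gate d (fun z y => gateKernel o y (z a) (z b) * gateKernel o y (z a) (z b))
    (fun y => (measurable_gateKernel y a b).mul (measurable_gateKernel y a b)) (S * S)
    (fun z y => by
      rw [abs_mul]
      exact mul_le_mul (abs_gateKernel_le _ (ho _) _ _) (abs_gateKernel_le _ (ho _) _ _)
        (abs_nonneg _) (Nat.cast_nonneg _))]
  have h4 : ((1 : ℝ) / 4) ^ S = (1 / 2) ^ S * (1 / 2) ^ S := by
    rw [← mul_pow]; norm_num
  have h2 : ((1 : ℝ) / 2) ^ S * 2 ^ S = 1 := by rw [← mul_pow]; norm_num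
  have : ∀ q : QubitGroup N S, ((1 : ℝ) / 2) ^ S * ∑ u : Fin S → Fin 2,
      ∫ ω, gateKernel o (q, u) (X a ω) (X b ω) * gateKernel o (q, u) (X a ω) (X b ω) ∂P =
      (1 / 4) ^ S := by
    intro q
    have hq := (ho q).ne'
    have e : ∀ u : Fin S → Fin 2,
        featureMoment o q q u u ^ 2 / (groupWeight o q * groupWeight o q) = (1 / 4) ^ S := by
      intro u
      rw [featureMoment_self, h4]
      field_simp
    simp_rw [h.integral_gateKernel_mul hab, e]
    simp only [Finset.sum_const, Finset.card_univ, Fintype.card_pi, Fintype.card_fin,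
      Finset.prod_const, nsmul_eq_mul]
    push_cast
    rw [← mul_assoc, h2, one_mul]
  simp_rw [this, ← Finset.sum_mul, h.sum_eq_one, one_mul]

theorem integral_gateKernel_self_mul [IsProbabilityMeasure P]
    (h : IsCircuitSample P X g p)
    (ho : ∀ q : QubitGroup N S, 0 < groupWeight o q) {d e : Fin D} (hde : d ≠ e) (a : Fin m) :
    ∫ ω, gateKernel o (g d ω) (X a ω) (X a ω) * gateKernel o (g e ω) (X a ω) (X a ω) ∂P =
      (1 / 4) ^ S := by
  rw [h.integral_comp_gate_gate hde
    (fun z y y' => gateKernel o y (z a) (z a) * gateKernel o y' (z a) (z a))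
    (fun y y' => (measurable_gateKernel y a a).mul (measurable_gateKernel y' a a)) (S * S)
    (fun z y y' => by
      rw [abs_mul]
      exact mul_le_mul (abs_gateKernel_le _ (ho _) _ _) (abs_gateKernel_le _ (ho _) _ _)
        (abs_nonneg _) (Nat.cast_nonneg _))]
  have hint : ∀ y y' : Gate N S, Integrable (fun ω =>
      gateKernel o y (X a ω) (X a ω) * gateKernel o y' (X a ω) (X a ω)) P := fun y y' =>
    (h.integrable_gateKernel_fixed ho y a a).mul_bdd
      ((measurable_gateKernel y' a a).comp h.measurable_inputs).aestronglyMeasurable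
      (Filter.Eventually.of_forall fun _ => abs_gateKernel_le _ (ho _) _ _)
  have : ∀ q q' : QubitGroup N S, ∑ u, ∑ u', ∫ ω, gateKernel o (q, u) (X a ω) (X a ω) *
      gateKernel o (q', u') (X a ω) (X a ω) ∂P = 1 := by
    intro q q'
    simp_rw [← integral_finsetSum _ fun u' _ => hint (q, _) (q', u')]
    rw [← integral_finsetSum _ fun u _ => integrable_finsetSum _ fun u' _ => hint (q, u) (q', u')]
    simp_rw [← Finset.mul_sum, sum_gateKernel_self q' (ho q'), mul_one,
      sum_gateKernel_self q (ho q)]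
    simp
  simp_rw [this, mul_one, ← Finset.sum_mul, ← Finset.mul_sum, h.sum_eq_one, mul_one,
    h.sum_eq_one, one_mul]

/-- For two different gates and two different inputs, only pairs of gates with the same group
contribute. -/
theorem integral_gateKernel_mul_le [IsProbabilityMeasure P]
    (h : IsCircuitSample P X g p)
    (ho : ∀ q : QubitGroup N S, 0 < groupWeight o q) {d e : Fin D} (hde : d ≠ e)
    {a b : Fin m} (hab : a ≠ b) :
    ∫ ω, gateKernel o (g d ω) (X a ω) (X b ω) * gateKernel o (g e ω) (X a ω) (X b ω) ∂P ≤
      3 * (1 / 8) ^ S * ∑ q, p d q * p e q := by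
  rw [h.integral_comp_gate_gate hde
    (fun z y y' => gateKernel o y (z a) (z b) * gateKernel o y' (z a) (z b))
    (fun y y' => (measurable_gateKernel y a b).mul (measurable_gateKernel y' a b)) (S * S)
    (fun z y y' => by
      rw [abs_mul]
      exact mul_le_mul (abs_gateKernel_le _ (ho _) _ _) (abs_gateKernel_le _ (ho _) _ _)
        (abs_nonneg _) (Nat.cast_nonneg _))]
  simp_rw [h.integral_gateKernel_mul hab]
  rw [Finset.mul_sum]
  refine Finset.sum_le_sum fun q _ => ?_
  rw [Finset.sum_eq_single q]
  · have hq := ho q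
    have hsum : ∑ u, ∑ u', featureMoment o q q u u' ^ 2 / (groupWeight o q * groupWeight o q) ≤
        2 ^ S * (3 * (1 / 4) ^ S) := by
      simp_rw [← Finset.sum_div]
      rw [div_le_iff₀ (by positivity)]
      refine (Finset.sum_le_sum fun u _ => sum_featureMoment_sq_le o q u).trans_eq ?_
      simp only [Finset.sum_const, Finset.card_univ, Fintype.card_pi, Fintype.card_fin,
        Finset.prod_const, nsmul_eq_mul]
      push_cast
      ring
    have h8 : ((1 : ℝ) / 4) ^ S * (2 ^ S * (3 * (1 / 4) ^ S)) = 3 * (1 / 8) ^ S := by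
      calc _ = 3 * ((1 / 4 * 2 * (1 / 4)) ^ S : ℝ) := by rw [mul_pow, mul_pow]; ring
        _ = _ := by norm_num
    calc _ ≤ p d q * p e q * ((1 / 4) ^ S * (2 ^ S * (3 * (1 / 4) ^ S))) := by
          have := h.nonneg d q
          have := h.nonneg e q
          gcongr
      _ = _ := by rw [h8]; ring
  · intro q' _ hq'
    simp [featureMoment_eq_zero o hq'.symm]
  · simp

/-! ### Second moment of the normalized kernel -/

/-- The contributions of two gates to the fluctuation of the normalized kernel are uncorrelated
up to a term that measures how often the gates use the same group. -/
theorem integral_fluctuation_mul_le [IsProbabilityMeasure P]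
    (h : IsCircuitSample P X g p)
    (ho : ∀ q : QubitGroup N S, 0 < groupWeight o q) (d e : Fin D) (a b : Fin m) :
    ∫ ω, (gateKernel o (g d ω) (X a ω) (X b ω) - if a = b then (1 / 2) ^ S else 0) *
      (gateKernel o (g e ω) (X a ω) (X b ω) - if a = b then (1 / 2) ^ S else 0) ∂P ≤
    (if d = e then ((if a = b then 1 else 0) + (1 / 4) ^ S) else 0) +
      3 * (1 / 8) ^ S * ∑ q, p d q * p e q := by
  have hpp : 0 ≤ 3 * (1 / 8 : ℝ) ^ S * ∑ q, p d q * p e q :=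
    mul_nonneg (by positivity) (Finset.sum_nonneg fun q _ => mul_nonneg (h.nonneg d q)
      (h.nonneg e q))
  have h4 : ((1 : ℝ) / 4) ^ S = (1 / 2) ^ S * (1 / 2) ^ S := by
    rw [← mul_pow]; norm_num
  by_cases hab : a = b
  · subst hab
    have hi : ∀ d, Integrable (fun ω => gateKernel o (g d ω) (X a ω) (X a ω)) P := fun d =>
      Integrable.of_bound (C := S) (h.measurable_gateKernel_gate d a a).aestronglyMeasurable
        (Filter.Eventually.of_forall fun _ => abs_gateKernel_le _ (ho _) _ _)
    have hii : Integrable (fun ω => gateKernel o (g d ω) (X a ω) (X a ω) *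
        gateKernel o (g e ω) (X a ω) (X a ω)) P :=
      (hi d).mul_bdd (h.measurable_gateKernel_gate e a a).aestronglyMeasurable
        (Filter.Eventually.of_forall fun _ => abs_gateKernel_le _ (ho _) _ _)
    have hexp : ∫ ω, (gateKernel o (g d ω) (X a ω) (X a ω) - (1 / 2) ^ S) *
        (gateKernel o (g e ω) (X a ω) (X a ω) - (1 / 2) ^ S) ∂P =
        ∫ ω, gateKernel o (g d ω) (X a ω) (X a ω) * gateKernel o (g e ω) (X a ω) (X a ω) ∂P -
          (1 / 4) ^ S := by
      have e1 : ∀ ω, (gateKernel o (g d ω) (X a ω) (X a ω) - (1 / 2) ^ S) *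
        (gateKernel o (g e ω) (X a ω) (X a ω) - (1 / 2) ^ S) =
        gateKernel o (g d ω) (X a ω) (X a ω) * gateKernel o (g e ω) (X a ω) (X a ω) -
        (1 / 2) ^ S * gateKernel o (g d ω) (X a ω) (X a ω) -
        (1 / 2) ^ S * gateKernel o (g e ω) (X a ω) (X a ω) + (1 / 4) ^ S := by
        intro ω; rw [h4]; ring
      have i1 : Integrable (fun ω => gateKernel o (g d ω) (X a ω) (X a ω) *
          gateKernel o (g e ω) (X a ω) (X a ω) -
          (1 / 2) ^ S * gateKernel o (g d ω) (X a ω) (X a ω)) P := hii.sub ((hi d).const_mul _)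
      have i2 : Integrable (fun ω => gateKernel o (g d ω) (X a ω) (X a ω) *
          gateKernel o (g e ω) (X a ω) (X a ω) -
          (1 / 2) ^ S * gateKernel o (g d ω) (X a ω) (X a ω) -
          (1 / 2) ^ S * gateKernel o (g e ω) (X a ω) (X a ω)) P := i1.sub ((hi e).const_mul _)
      simp_rw [e1]
      rw [integral_add i2 (integrable_const _), integral_sub i1 ((hi e).const_mul _),
        integral_sub hii ((hi d).const_mul _), integral_const_mul, integral_const_mul,
        h.integral_gateKernel_self ho, h.integral_gateKernel_self ho]
      simp only [integral_const, probReal_univ, one_smul]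
      rw [h4]; ring
    simp only [if_true]
    rw [hexp]
    by_cases hde : d = e
    · subst hde
      have := h.integral_gateKernel_self_sq_le ho d a
      have h0 : (0 : ℝ) ≤ (1 / 4) ^ S := by positivity
      rw [if_pos rfl]
      linarith
    · rw [h.integral_gateKernel_self_mul ho hde, if_neg hde]
      linarith
  · simp only [if_neg hab, sub_zero]
    by_cases hde : d = e
    · subst hde
      rw [h.integral_gateKernel_sq ho d hab, if_pos rfl]
      linarith
    · rw [if_neg hde, zero_add]
      exact h.integral_gateKernel_mul_le ho hde hab

theorem integrable_fluctuation_mul [IsProbabilityMeasure P]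
    (h : IsCircuitSample P X g p)
    (ho : ∀ q : QubitGroup N S, 0 < groupWeight o q) (d e : Fin D) (a b : Fin m) :
    Integrable (fun ω => (gateKernel o (g d ω) (X a ω) (X b ω) - if a = b then (1 / 2) ^ S else 0) *
      (gateKernel o (g e ω) (X a ω) (X b ω) - if a = b then (1 / 2) ^ S else 0)) P := by
  have hm : ∀ d, Measurable fun ω =>
      gateKernel o (g d ω) (X a ω) (X b ω) - if a = b then (1 / 2) ^ S else 0 := fun d =>
    (h.measurable_gateKernel_gate d a b).sub_const _
  have hb : ∀ d ω, ‖gateKernel o (g d ω) (X a ω) (X b ω) - if a = b then (1 / 2) ^ S else 0‖ ≤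
      S + ‖(if a = b then (1 / 2) ^ S else 0 : ℝ)‖ := fun d ω =>
    (norm_sub_le _ _).trans (add_le_add_left (abs_gateKernel_le _ (ho _) _ _) _)
  exact (Integrable.of_bound (hm d).aestronglyMeasurable _
    (Filter.Eventually.of_forall (hb d))).mul_bdd (hm e).aestronglyMeasurable
    (Filter.Eventually.of_forall (hb e))

theorem integrable_fluctuation [IsProbabilityMeasure P]
    (h : IsCircuitSample P X g p)
    (ho : ∀ q : QubitGroup N S, 0 < groupWeight o q) :
    Integrable (fun ω => fluctuation o (fun d => g d ω) (fun a => X a ω)) P := by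
  simp_rw [fluctuation_eq]
  exact integrable_finsetSum _ fun a _ => integrable_finsetSum _ fun b _ =>
    (integrable_finsetSum _ fun d _ => integrable_finsetSum _ fun e _ =>
      h.integrable_fluctuation_mul ho d e a b).const_mul _

theorem integral_fluctuation_le [IsProbabilityMeasure P]
    (h : IsCircuitSample P X g p)
    (ho : ∀ q : QubitGroup N S, 0 < groupWeight o q) (hD : 0 < D) :
    ∫ ω, fluctuation o (fun d => g d ω) (fun a => X a ω) ∂P ≤
      (m + (m : ℝ) ^ 2 * (1 / 4) ^ S) / D +
        3 * (m : ℝ) ^ 2 * (1 / 8) ^ S * ∑ q, ((1 / (D : ℝ)) * ∑ d, p d q) ^ 2 := by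
  have hD' : (0 : ℝ) < D := by exact_mod_cast hD
  have hI := fun d e a b => h.integrable_fluctuation_mul ho d e a b
  simp_rw [fluctuation_eq]
  rw [integral_finsetSum _ fun a _ => integrable_finsetSum _ fun b _ =>
    (integrable_finsetSum _ fun d _ => integrable_finsetSum _ fun e _ => hI d e a b).const_mul _]
  have hab : ∀ a b : Fin m, ∫ ω, (1 / (D : ℝ)) ^ 2 * ∑ d, ∑ e,
      (gateKernel o (g d ω) (X a ω) (X b ω) - if a = b then (1 / 2) ^ S else 0) *
      (gateKernel o (g e ω) (X a ω) (X b ω) - if a = b then (1 / 2) ^ S else 0) ∂P ≤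
      ((if a = b then 1 else 0 : ℝ) + (1 / 4) ^ S) / (D : ℝ) +
        3 * (1 / 8) ^ S * ∑ q, ((1 / (D : ℝ)) * ∑ d, p d q) ^ 2 := by
    intro a b
    rw [integral_const_mul, integral_finsetSum _ fun d _ => integrable_finsetSum _ fun e _ =>
      hI d e a b]
    simp_rw [integral_finsetSum _ fun e _ => hI _ e a b]
    refine (mul_le_mul_of_nonneg_left (Finset.sum_le_sum fun d _ => Finset.sum_le_sum fun e _ =>
      h.integral_fluctuation_mul_le ho d e a b) (by positivity)).trans_eq ?_
    have hq : ∑ d, ∑ e, 3 * (1 / 8 : ℝ) ^ S * ∑ q, p d q * p e q =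
        3 * (1 / 8) ^ S * ∑ q, (∑ d, p d q) ^ 2 := by
      simp_rw [← Finset.mul_sum]
      congr 1
      simp_rw [pow_two, Finset.sum_mul_sum]
      rw [Finset.sum_comm' (t' := Finset.univ) (s' := fun _ => Finset.univ) (by simp)]
      simp_rw [Finset.sum_comm (s := (Finset.univ : Finset (Fin D)))
        (t := (Finset.univ : Finset (QubitGroup N S)))]
      rw [Finset.sum_congr rfl fun q _ => Finset.sum_comm]
    simp_rw [Finset.sum_add_distrib, hq, mul_pow, ← Finset.mul_sum]
    simp only [Finset.sum_ite_eq, Finset.mem_univ, if_true, Finset.sum_const, Finset.card_univ,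
      Fintype.card_fin, nsmul_eq_mul]
    field_simp
  have hint : ∀ a : Fin m, ∫ ω, ∑ b, (1 / (D : ℝ)) ^ 2 * ∑ d, ∑ e,
      (gateKernel o (g d ω) (X a ω) (X b ω) - if a = b then (1 / 2) ^ S else 0) *
      (gateKernel o (g e ω) (X a ω) (X b ω) - if a = b then (1 / 2) ^ S else 0) ∂P =
      ∑ b, ∫ ω, (1 / (D : ℝ)) ^ 2 * ∑ d, ∑ e,
      (gateKernel o (g d ω) (X a ω) (X b ω) - if a = b then (1 / 2) ^ S else 0) *
      (gateKernel o (g e ω) (X a ω) (X b ω) - if a = b then (1 / 2) ^ S else 0) ∂P := fun a =>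
    integral_finsetSum _ fun b _ => (integrable_finsetSum _ fun d _ =>
      integrable_finsetSum _ fun e _ => hI d e a b).const_mul _
  simp_rw [hint]
  refine (Finset.sum_le_sum fun a _ => Finset.sum_le_sum fun b _ => hab a b).trans_eq ?_
  simp_rw [Finset.sum_add_distrib, ← Finset.sum_div, Finset.sum_add_distrib]
  simp only [Finset.sum_ite_eq, Finset.mem_univ, if_true, Finset.sum_const, Finset.card_univ,
    Fintype.card_fin, nsmul_eq_mul, mul_one]
  ring

end IsCircuitSample

/-! ### From the normalized kernel to the eigenvalues -/

/-- Rescaling the features of each gate by the weight of its group changes the quadratic form of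
the kernel by a factor between the smallest and the largest weight, and the rescaled kernel is
close to `2⁻ˢ` times the identity. -/
theorem eigenvalue_bounds_of_fluctuation_le {N S D m : ℕ} {o : Fin N → ℝ} {g : Fin D → Gate N S}
    {X : Fin m → Fin N → ℝ} {Δ L k : ℝ} (hk : k ∈ Set.Ioo (0 : ℝ) 1) (hD : 0 < D) (hΔ : 0 < Δ)
    (hlow : ∀ q : QubitGroup N S, Δ ≤ groupWeight o q)
    (hup : ∀ q : QubitGroup N S, groupWeight o q ≤ L)
    (hfl : fluctuation o g X ≤ (k / 2 ^ S) ^ 2)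
    (J : Matrix (Fin D) (Fin m) ℝ) (hJ : ∀ d a, J d a = feature o (g d).1 (g d).2 (X a)) (lam : ℝ)
    (hlam : Module.End.HasEigenvalue (Matrix.toLin' ((1 / (D : ℝ)) • (J.transpose * J))) lam) :
    (1 - k) * Δ / 2 ^ S ≤ lam ∧ lam ≤ (1 + k) * L / 2 ^ S := by
  obtain ⟨v, hv⟩ := hlam.exists_hasEigenvector
  have hv0 := hv.2
  have hvK : (1 / (D : ℝ)) • (J.transpose *ᵥ (J *ᵥ v)) = lam • v := by
    rw [Matrix.mulVec_mulVec, ← Matrix.smul_mulVec, ← Matrix.toLin'_apply]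
    exact hv.apply_eq_smul
  have hD' : (0 : ℝ) < D := by exact_mod_cast hD
  set n2 := v ⬝ᵥ v with hn2
  have hn2_pos : 0 < n2 := by
    have h0 : 0 ≤ n2 := Finset.sum_nonneg fun a _ => mul_self_nonneg _
    exact lt_of_le_of_ne h0 fun h => hv0 (dotProduct_self_eq_zero.mp h.symm)
  have hquad : lam * n2 = (1 / (D : ℝ)) * ∑ d, (J *ᵥ v) d ^ 2 := by
    have h := congrArg (fun z => v ⬝ᵥ z) hvK
    simp only [dotProduct_smul, smul_eq_mul] at h
    rw [← h, Matrix.dotProduct_mulVec, Matrix.vecMul_transpose]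
    simp [dotProduct, pow_two]
  set R := (1 / (D : ℝ)) * ∑ d, (J *ᵥ v) d ^ 2 / groupWeight o (g d).1 with hR
  have hRlow : Δ * R ≤ lam * n2 := by
    rw [hquad, hR, mul_left_comm, Finset.mul_sum]
    refine mul_le_mul_of_nonneg_left (Finset.sum_le_sum fun d _ => ?_) (by positivity)
    have hp := hΔ.trans_le (hlow (g d).1)
    rw [mul_div_assoc', div_le_iff₀ hp, mul_comm]
    exact mul_le_mul_of_nonneg_left (hlow _) (sq_nonneg _)
  have hRup : lam * n2 ≤ L * R := by
    rw [hquad, hR, mul_left_comm, Finset.mul_sum _ _ L]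
    refine mul_le_mul_of_nonneg_left (Finset.sum_le_sum fun d _ => ?_) (by positivity)
    have hp := hΔ.trans_le (hlow (g d).1)
    rw [mul_div_assoc', le_div_iff₀ hp, mul_comm]
    exact mul_le_mul_of_nonneg_right (hup _) (sq_nonneg _)
  let E : Fin m → Fin m → ℝ := fun a b => (1 / (D : ℝ)) * ∑ d, (gateKernel o (g d) (X a) (X b) -
    if a = b then (1 / 2) ^ S else 0)
  -- `R` is the quadratic form of the normalized kernel at `v`.
  have hE : R - (1 / 2) ^ S * n2 = ∑ z : Fin m × Fin m, E z.1 z.2 * (v z.1 * v z.2) := by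
    have h1 : ∀ d, (J *ᵥ v) d ^ 2 / groupWeight o (g d).1 =
        ∑ a, ∑ b, gateKernel o (g d) (X a) (X b) * (v a * v b) := by
      intro d
      simp only [Matrix.mulVec, dotProduct, pow_two, Finset.sum_mul_sum, Finset.sum_div, hJ,
        gateKernel]
      refine Finset.sum_congr rfl fun a _ => Finset.sum_congr rfl fun b _ => by ring
    have h2 : ∑ a, ∑ b, (if a = b then (1 / 2 : ℝ) ^ S else 0) * (v a * v b) =
        (1 / 2) ^ S * n2 := by
      simp [dotProduct, hn2, Finset.mul_sum]
    have h3 : ∀ d : Fin D, ∑ a, ∑ b, (gateKernel o (g d) (X a) (X b) -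
        if a = b then (1 / 2 : ℝ) ^ S else 0) * (v a * v b) =
        (J *ᵥ v) d ^ 2 / groupWeight o (g d).1 - (1 / 2) ^ S * n2 := by
      intro d
      rw [h1, ← h2]
      simp_rw [sub_mul, Finset.sum_sub_distrib]
    rw [Fintype.sum_prod_type]
    have h4 : ∑ a, ∑ b, E a b * (v a * v b) = (1 / (D : ℝ)) * ∑ d : Fin D, ∑ a, ∑ b,
        (gateKernel o (g d) (X a) (X b) - if a = b then (1 / 2 : ℝ) ^ S else 0) *
          (v a * v b) := by
      simp only [E, mul_assoc, Finset.sum_mul, ← Finset.mul_sum]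
      congr 1
      rw [Finset.sum_comm]
      simp_rw [Finset.sum_comm (s := (Finset.univ : Finset (Fin m)))
        (t := (Finset.univ : Finset (Fin D)))]
      rw [Finset.sum_congr rfl fun d _ => Finset.sum_comm]
    rw [h4]
    simp_rw [h3]
    rw [Finset.sum_sub_distrib, hR, Finset.sum_const, Finset.card_univ, Fintype.card_fin,
      nsmul_eq_mul]
    field_simp
  -- Cauchy-Schwarz: the quadratic form of `E` at `v` is at most its Frobenius norm times `v ⬝ᵥ v`.
  have hCS : (R - (1 / 2) ^ S * n2) ^ 2 ≤ (k / 2 ^ S * n2) ^ 2 := by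
    rw [hE]
    refine (Finset.sum_mul_sq_le_sq_mul_sq _ _ _).trans ?_
    have h1 : ∑ z : Fin m × Fin m, E z.1 z.2 ^ 2 = fluctuation o g X := by
      rw [Fintype.sum_prod_type]; rfl
    have h2 : ∑ z : Fin m × Fin m, (v z.1 * v z.2) ^ 2 = n2 ^ 2 := by
      rw [Fintype.sum_prod_type, hn2, dotProduct, pow_two, Finset.sum_mul_sum]
      refine Finset.sum_congr rfl fun a _ => Finset.sum_congr rfl fun b _ => by ring
    rw [h1, h2, mul_pow]
    exact mul_le_mul_of_nonneg_right hfl (sq_nonneg _)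
  have h2S : (0 : ℝ) < 2 ^ S := by positivity
  have hkn : 0 ≤ k / 2 ^ S * n2 := mul_nonneg (div_nonneg hk.1.le h2S.le) hn2_pos.le
  have habs := abs_le.mp (abs_le_of_sq_le_sq hCS hkn)
  have hhalf : ((1 : ℝ) / 2) ^ S = 1 / 2 ^ S := by rw [div_pow, one_pow]
  rw [hhalf] at habs
  have hq0 : (0 : ℝ) ≤ L := by
    obtain ⟨d⟩ : Nonempty (Fin D) := ⟨⟨0, hD⟩⟩
    exact hΔ.le.trans ((hlow (g d).1).trans (hup _))
  constructor
  · refine le_of_mul_le_mul_right (le_trans ?_ hRlow) hn2_pos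
    have : (1 - k) / 2 ^ S * n2 ≤ R := by
      have e : (1 - k) / 2 ^ S * n2 = 1 / 2 ^ S * n2 - k / 2 ^ S * n2 := by ring
      linarith [habs.1]
    calc (1 - k) * Δ / 2 ^ S * n2 = Δ * ((1 - k) / 2 ^ S * n2) := by ring
      _ ≤ Δ * R := mul_le_mul_of_nonneg_left this hΔ.le
  · refine le_of_mul_le_mul_right (hRup.trans ?_) hn2_pos
    have : R ≤ (1 + k) / 2 ^ S * n2 := by
      have e : (1 + k) / 2 ^ S * n2 = 1 / 2 ^ S * n2 + k / 2 ^ S * n2 := by ring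
      linarith [habs.2]
    calc L * R ≤ L * ((1 + k) / 2 ^ S * n2) := mul_le_mul_of_nonneg_left this hq0
      _ = _ := by ring

/-! ### The sample size -/

/-- The arithmetic of Chebyshev's bound: `A` stands for `2 ^ S`, `c` for the number of groups and
`r` for `‖O‖² / Δ_S`. -/
theorem second_moment_le_of_sample_size {m r k δ A c D : ℝ} (hm : 1 ≤ m)
    (hk : k ∈ Set.Ioo (0 : ℝ) 1) (hδ : δ ∈ Set.Ioo (0 : ℝ) 1) (hA : 0 < A) (hc : 0 < c)
    (hr : 1 ≤ r) (h1 : A ^ 2 ≤ 16 * r) (h2 : A * c ≤ 64 * r ^ 2)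
    (h3 : 16 * m ^ 2 ≤ A * c * (k ^ 2 * δ ^ 2)) (hD : 128 * (m * r ^ 2 / k ^ 2) ≤ D) :
    (m + m ^ 2 * (1 / A ^ 2)) / D + 3 * m ^ 2 * (1 / A ^ 3) * (1 / c) ≤ δ * (k / A) ^ 2 := by
  obtain ⟨hk0, hk1⟩ := hk
  obtain ⟨hδ0, hδ1⟩ := hδ
  have hm0 : 0 < m := by linarith
  have hkδ : 0 < k * δ := mul_pos hk0 hδ0
  -- The upper bound `h2` and the lower bound `h3` on `2 ^ S * |Q|` combine to `r ≥ m / (2 k δ)`.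
  have hrm : m ≤ 2 * r * (k * δ) := by
    refine (pow_le_pow_iff_left₀ hm0.le (by positivity) two_ne_zero).mp ?_
    have : 16 * m ^ 2 ≤ 64 * r ^ 2 * (k ^ 2 * δ ^ 2) :=
      h3.trans (mul_le_mul_of_nonneg_right h2 (by positivity))
    linarith [show (2 * r * (k * δ)) ^ 2 = 4 * (r ^ 2 * (k ^ 2 * δ ^ 2)) by ring]
  have hrδ : m ≤ 2 * r * δ := hrm.trans (by
    have : k * δ ≤ δ := mul_le_of_le_one_left hδ0.le hk1.le
    exact mul_le_mul_of_nonneg_left this (by positivity))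
  have hX : 0 < m * r ^ 2 / k ^ 2 := by positivity
  have hD0 : 0 < D := by linarith
  have hDk : 128 * (m * r ^ 2) ≤ D * k ^ 2 := by
    have : 128 * (m * r ^ 2) = 128 * (m * r ^ 2 / k ^ 2) * k ^ 2 := by field_simp
    rw [this]
    exact mul_le_mul_of_nonneg_right hD (by positivity)
  have t1 : m / D ≤ δ * (k / A) ^ 2 / 4 := by
    rw [div_pow, div_le_iff₀ hD0]
    have e : δ * (k ^ 2 / A ^ 2) / 4 * D = δ * (D * k ^ 2) / (4 * A ^ 2) := by
      field_simp
    rw [e, le_div_iff₀ (by positivity)]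
    have s1 : δ * (128 * (m * r ^ 2)) ≤ δ * (D * k ^ 2) := mul_le_mul_of_nonneg_left hDk hδ0.le
    have s2 : m * (4 * A ^ 2) ≤ m * (64 * r) := mul_le_mul_of_nonneg_left (by linarith) hm0.le
    have s3 : m * (64 * r) * 1 ≤ m * (64 * r) * (2 * r * δ) :=
      mul_le_mul_of_nonneg_left (hm.trans hrδ) (by positivity)
    linarith
  have t2 : m ^ 2 * (1 / A ^ 2) / D ≤ δ * (k / A) ^ 2 / 4 := by
    have e : δ * (k / A) ^ 2 / 4 = δ * k ^ 2 / 4 * (1 / A ^ 2) := by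
      rw [div_pow]; ring
    rw [e, div_le_iff₀ hD0, mul_right_comm]
    refine mul_le_mul_of_nonneg_right ?_ (by positivity)
    have s1 : δ * (128 * (m * r ^ 2)) ≤ δ * (D * k ^ 2) := mul_le_mul_of_nonneg_left hDk hδ0.le
    have s3 : m * m ≤ m * (2 * r * δ) := mul_le_mul_of_nonneg_left hrδ hm0.le
    have s4 : m * r * δ * 1 ≤ m * r * δ * r := mul_le_mul_of_nonneg_left hr (by positivity)
    have s5 : 0 ≤ m * r * δ * r := by positivity
    linarith
  have t3 : 3 * m ^ 2 * (1 / A ^ 3) * (1 / c) ≤ δ * (k / A) ^ 2 / 4 := by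
    have e1 : 3 * m ^ 2 * (1 / A ^ 3) * (1 / c) = 3 * m ^ 2 / (A * c) * (1 / A ^ 2) := by
      field_simp
    have e2 : δ * (k / A) ^ 2 / 4 = δ * k ^ 2 / 4 * (1 / A ^ 2) := by
      rw [div_pow]; ring
    rw [e1, e2]
    refine mul_le_mul_of_nonneg_right ?_ (by positivity)
    rw [div_le_iff₀ (by positivity)]
    have s1 : A * c * (k ^ 2 * δ ^ 2) ≤ A * c * (k ^ 2 * δ) :=
      mul_le_mul_of_nonneg_left (mul_le_mul_of_nonneg_left (by nlinarith) (by positivity))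
        (by positivity)
    have s2 : 0 ≤ A * c * (k ^ 2 * δ) := by positivity
    linarith
  have t4 : 0 ≤ δ * (k / A) ^ 2 / 4 := by positivity
  rw [add_div]
  linarith

theorem one_le_log_of_three_le {x : ℝ} (hx : 3 ≤ x) : 1 ≤ Real.log x := by
  rw [Real.le_log_iff_exp_le (by linarith)]
  linarith [Real.exp_one_lt_d9]

/-- Both logarithms in the hypothesis on the number of gates are at least `1`, which is all that is
used of them. -/
theorem le_of_gateThreshold_mul_log_le {N : ℕ} {m S D : ℕ} {o : Fin N → ℝ} {k δ : ℝ} (hm : 3 ≤ m)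
    (hk : k ∈ Set.Ioo (0 : ℝ) 1) (hδ : δ ∈ Set.Ioo (0 : ℝ) 1)
    (hr : 1 ≤ opNorm (observable o) ^ 2 / gapDelta S o)
    (hD : gateThreshold 128 m S o k δ * Real.log (gateThreshold 128 m S o k δ / δ) ≤ (D : ℝ)) :
    128 * ((m : ℝ) * (opNorm (observable o) ^ 2 / gapDelta S o) ^ 2 / k ^ 2) ≤ (D : ℝ) := by
  have hm' : (3 : ℝ) ≤ m := by exact_mod_cast hm
  set Y := 128 * ((m : ℝ) * (opNorm (observable o) ^ 2 / gapDelta S o) ^ 2 / k ^ 2) with hY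
  have hT : gateThreshold 128 m S o k δ = Y * Real.log ((m : ℝ) / δ) := by
    rw [gateThreshold, hY, div_pow, ← pow_mul]
    congr 2
    rw [mul_div_assoc', div_div, mul_comm (k ^ 2)]
  have hdiv : ∀ y : ℝ, 0 ≤ y → y ≤ y / δ := fun y hy => by
    rw [le_div_iff₀ hδ.1]
    exact mul_le_of_le_one_right hy hδ.2.le
  have hY3 : 3 ≤ Y := by
    have h1 : (3 : ℝ) ≤ m * (opNorm (observable o) ^ 2 / gapDelta S o) ^ 2 / k ^ 2 := by
      rw [le_div_iff₀ (by have := hk.1; positivity)]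
      have a1 : k ^ 2 ≤ 1 := pow_le_one₀ hk.1.le hk.2.le
      have a2 : (m : ℝ) * 1 ≤ m * (opNorm (observable o) ^ 2 / gapDelta S o) ^ 2 :=
        mul_le_mul_of_nonneg_left (one_le_pow₀ hr) (by linarith)
      linarith
    linarith
  have hl : 1 ≤ Real.log ((m : ℝ) / δ) :=
    one_le_log_of_three_le (hm'.trans (hdiv _ (by linarith)))
  have hYT : Y ≤ gateThreshold 128 m S o k δ := by
    rw [hT]; exact le_mul_of_one_le_right (by linarith) hl
  have hl2 : 1 ≤ Real.log (gateThreshold 128 m S o k δ / δ) :=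
    one_le_log_of_three_le ((hY3.trans hYT).trans (hdiv _ (by linarith)))
  exact hYT.trans ((le_mul_of_one_le_right (by linarith) hl2).trans hD)

theorem sq_le_two_pow_mul_of_logb_le {m S c : ℕ} {k δ : ℝ} (hm : 3 ≤ m) (hc : 0 < c)
    (hk : 0 < k) (hδ : 0 < δ)
    (hS : 2 + Real.logb 2 ((2 : ℝ) ^ 2 * (m : ℝ) ^ 2 * Real.log (m : ℝ) /
      (k ^ 2 * (c : ℝ) * δ ^ 2)) ≤ (S : ℝ)) :
    16 * (m : ℝ) ^ 2 ≤ 2 ^ S * c * (k ^ 2 * δ ^ 2) := by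
  have hm' : (3 : ℝ) ≤ m := by exact_mod_cast hm
  have hc' : (0 : ℝ) < c := by exact_mod_cast hc
  have hl := one_le_log_of_three_le hm'
  set Z := (2 : ℝ) ^ 2 * (m : ℝ) ^ 2 * Real.log (m : ℝ) / (k ^ 2 * (c : ℝ) * δ ^ 2) with hZ
  have hZ0 : 0 < Z := by positivity
  have h : 4 * Z ≤ 2 ^ S := by
    have h1 : Real.logb 2 Z ≤ S - 2 := by linarith
    rw [Real.logb_le_iff_le_rpow (by norm_num) hZ0, Real.rpow_sub (by norm_num),
      Real.rpow_natCast] at h1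
    norm_num at h1
    linarith
  have h2 : 4 * Z * (k ^ 2 * c * δ ^ 2) ≤ 2 ^ S * (k ^ 2 * c * δ ^ 2) :=
    mul_le_mul_of_nonneg_right h (by positivity)
  have h3 : 4 * Z * (k ^ 2 * c * δ ^ 2) = 16 * (m : ℝ) ^ 2 * Real.log m := by
    rw [hZ]; field_simp; ring
  have h4 : 16 * (m : ℝ) ^ 2 * 1 ≤ 16 * (m : ℝ) ^ 2 * Real.log m :=
    mul_le_mul_of_nonneg_left hl (by positivity)
  linarith

/-- The hypotheses on the inputs and the gates give a circuit sample whose gate `d` has the group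
probabilities of `s d`. -/
theorem isCircuitSample_of_iIndepFun {Ω : Type*} [MeasurableSpace Ω] {P : Measure Ω}
    [IsProbabilityMeasure P] {m N S D : ℕ} {x : Fin m → Fin N → Ω → ℝ}
    {s : Fin D → Ω → QubitGroup N S} {w : Fin D → Ω → (Fin S → Fin 2)}
    (hx : ∀ a n, Measurable (x a n))
    (hU : ∀ a n, pdf.IsUniform (x a n) (Set.Icc (-1 : ℝ) 1) P volume)
    (hxi : ProbabilityTheory.iIndepFun (fun (p : Fin m × Fin N) => x p.1 p.2) P)
    (hs : ∀ d, Measurable (s d)) (hw : ∀ d, Measurable (w d))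
    (hgi : ProbabilityTheory.iIndepFun (fun d ω => (s d ω, w d ω)) P)
    (hxg : ProbabilityTheory.IndepFun (fun ω a n => x a n ω) (fun ω d => (s d ω, w d ω)) P)
    (hsw : ∀ d, ProbabilityTheory.IndepFun (s d) (w d) P)
    (hwu : ∀ d v, P.real {ω | w d ω = v} = 1 / (2 : ℝ) ^ S) :
    IsCircuitSample P (fun a ω n => x a n ω) (fun d ω => (s d ω, w d ω))
      (fun d q => P.real {ω | s d ω = q}) where
  measurable_input a := measurable_pi_lambda _ (hx a)
  law_input a := by
    have h := hxi.precomp (g := fun n : Fin N => (a, n)) fun n n' h => (Prod.ext_iff.mp h).2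
    rw [h.map_fun_eq_pi_map fun n => (hx a n).aemeasurable]
    congr 1
    funext n
    exact hU a n
  indep_input a b hab := by
    have h := hxi.indepFun_finset (Finset.univ.filter fun z => z.1 = a)
      (Finset.univ.filter fun z => z.1 = b) (by
        rw [Finset.disjoint_left]
        intro z hz hz'
        rw [Finset.mem_filter] at hz hz'
        exact hab (hz.2.symm.trans hz'.2)) (fun z => hx z.1 z.2)
    exact h.comp (φ := fun z (n : Fin N) => z ⟨(a, n), by simp⟩)
      (ψ := fun z (n : Fin N) => z ⟨(b, n), by simp⟩)
      (measurable_pi_lambda _ fun n => measurable_pi_apply _)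
      (measurable_pi_lambda _ fun n => measurable_pi_apply _)
  measurable_gate d := (hs d).prodMk (hw d)
  indep_gate d e hde := hgi.indepFun hde
  indep := hxg
  law_gate d q u := by
    have h := (hsw d).measure_inter_preimage_eq_mul {q} {u} (measurableSet_singleton _)
      (measurableSet_singleton _)
    have h2 : ((1 : ℝ) / 2) ^ S = P.real {ω | w d ω = u} := by rw [hwu, div_pow, one_pow]
    rw [h2, measureReal_def, measureReal_def, measureReal_def, ← ENNReal.toReal_mul]
    refine congrArg _ (Eq.trans ?_ h)
    congr 1
    ext ω; simp
  nonneg d q := measureReal_nonneg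
  sum_eq_one d := by
    have h := sum_measureReal_preimage_singleton (μ := P) (f := s d) Finset.univ
      fun q _ => hs d (measurableSet_singleton q)
    rw [Finset.coe_univ, Set.preimage_univ, probReal_univ] at h
    exact h

end QNTK

theorem mainTheorem7 :
    ∃ C₁ C₂ : ℝ, 0 < C₁ ∧ 0 < C₂ ∧ ∃ m₀ : ℕ,
      ∀ (m : ℕ), m₀ ≤ m →
      ∀ (N S D : ℕ) (o : Fin N → ℝ) (Q : Finset (QNTK.QubitGroup N S)) (δ k : ℝ),
      Q.Nonempty →
      0 < QNTK.gapDelta S o →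
      δ ∈ Set.Ioo (0 : ℝ) 1 →
      k ∈ Set.Ioo (0 : ℝ) 1 →
      QNTK.gateThreshold C₂ m S o k δ * Real.log (QNTK.gateThreshold C₂ m S o k δ / δ) ≤ (D : ℝ) →
      2 + Real.logb 2 (C₁ ^ 2 * (m : ℝ) ^ 2 * Real.log (m : ℝ) /
          (k ^ 2 * (Q.card : ℝ) * δ ^ 2)) ≤ (S : ℝ) →
      ∀ (Ω : Type*) [MeasurableSpace Ω] (P : MeasureTheory.Measure Ω)
        [MeasureTheory.IsProbabilityMeasure P]
        (x : Fin m → Fin N → Ω → ℝ)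
        (s : Fin D → Ω → QNTK.QubitGroup N S)
        (w : Fin D → Ω → (Fin S → Fin 2)),
      -- the entries of the input vectors: i.i.d., uniform on `[-1, 1]`
      (∀ a n, Measurable (x a n)) →
      (∀ a n, MeasureTheory.pdf.IsUniform (x a n) (Set.Icc (-1 : ℝ) 1) P MeasureTheory.volume) →
      ProbabilityTheory.iIndepFun (fun (p : Fin m × Fin N) => x p.1 p.2) P →
      -- the gates: independent of each other, and of the inputs
      (∀ d, Measurable (s d)) →
      (∀ d, Measurable (w d)) →
      ProbabilityTheory.iIndepFun (fun d ω => (s d ω, w d ω)) P →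
      ProbabilityTheory.IndepFun (fun ω a n => x a n ω) (fun ω d => (s d ω, w d ω)) P →
      -- the Hamiltonian of each gate is uniform on `{X, Y}^{⊗ S}`, whatever its qubit group
      (∀ d, ProbabilityTheory.IndepFun (s d) (w d) P) →
      (∀ d v, P.real {ω | w d ω = v} = 1 / (2 : ℝ) ^ S) →
      -- the qubit groups of the gates are, on average over the gates, uniform on `Q`
      (∀ q, (1 / (D : ℝ)) * ∑ d, P.real {ω | s d ω = q} =
        if q ∈ Q then 1 / (Q.card : ℝ) else 0) →
      ENNReal.ofReal (1 - δ) ≤ P {ω | ∀ lam : ℝ,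
        Module.End.HasEigenvalue (Matrix.toLin' (QNTK.qntk (QNTK.observable o)
          (fun d => QNTK.hamiltonian (s d ω) (w d ω))
          (fun a => QNTK.embeddingState (fun n => x a n ω)) 0)) lam →
        (1 - k) * QNTK.gapDelta S o / 2 ^ S ≤ lam ∧
          lam ≤ (1 + k) * QNTK.opNorm (QNTK.observable o) ^ 2 / 2 ^ S} := by
  refine ⟨2, 128, by norm_num, by norm_num, 3, ?_⟩
  intro m hm N S D o Q δ k hQ hΔ hδ hk hD hS Ω _ P _ x s w hx hU hxi hs hw hgi hxg hsw hwu hsQ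
  obtain ⟨hS1, -⟩ := QNTK.one_le_of_gapDelta_pos hΔ
  obtain ⟨hr, h4S, hQS⟩ := QNTK.two_pow_and_card_le hΔ Q hQ
  have hDr := QNTK.le_of_gateThreshold_mul_log_le hm hk hδ hr hD
  have hSm := QNTK.sq_le_two_pow_mul_of_logb_le hm hQ.card_pos hk.1 hδ.1 hS
  have hm1 : (1 : ℝ) ≤ m := by exact_mod_cast (by omega : 1 ≤ m)
  have hQ0 : (0 : ℝ) < Q.card := by exact_mod_cast hQ.card_pos
  have hDpos : 0 < D := by
    have : (0 : ℝ) < D := lt_of_lt_of_le (by have := hk.1; positivity) hDr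
    exact_mod_cast this
  have hlow := QNTK.gapDelta_le_groupWeight (S := S) o hS1
  have hup := QNTK.groupWeight_le_opNorm_sq (S := S) o
  have ho : ∀ q : QNTK.QubitGroup N S, 0 < QNTK.groupWeight o q := fun q => hΔ.trans_le (hlow q)
  have hsample := QNTK.isCircuitSample_of_iIndepFun hx hU hxi hs hw hgi hxg hsw hwu
  set f : Ω → ℝ := fun ω => QNTK.fluctuation o (fun d => (s d ω, w d ω))
    (fun a n => x a n ω) with hf
  have hA : (0 : ℝ) < 2 ^ S := by positivity
  have hε : (0 : ℝ) < (k / 2 ^ S) ^ 2 := by have := hk.1; positivity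
  have hmean : ∫ ω, f ω ∂P ≤ δ * (k / 2 ^ S) ^ 2 := by
    refine (hsample.integral_fluctuation_le ho hDpos).trans ?_
    have e1 : ∑ q, ((1 / (D : ℝ)) * ∑ d, P.real {ω | s d ω = q}) ^ 2 = 1 / (Q.card : ℝ) := by
      simp only [hsQ, ite_pow, ne_eq, OfNat.ofNat_ne_zero, not_false_eq_true, zero_pow]
      rw [Finset.sum_ite_mem, Finset.univ_inter, Finset.sum_const, nsmul_eq_mul]
      field_simp
    have e2 : ((1 : ℝ) / 4) ^ S = 1 / (2 ^ S) ^ 2 := by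
      rw [div_pow, one_pow, ← pow_mul, mul_comm, pow_mul]; norm_num
    have e3 : ((1 : ℝ) / 8) ^ S = 1 / (2 ^ S) ^ 3 := by
      rw [div_pow, one_pow, ← pow_mul, mul_comm, pow_mul]; norm_num
    rw [e1, e2, e3]
    refine QNTK.second_moment_le_of_sample_size hm1 hk hδ hA hQ0 hr ?_ hQS hSm hDr
    rwa [← pow_mul, mul_comm, pow_mul, show (2 : ℝ) ^ 2 = 4 by norm_num]
  have hf0 : ∀ ω, 0 ≤ f ω := fun ω =>
    Finset.sum_nonneg fun a _ => Finset.sum_nonneg fun b _ => sq_nonneg _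
  -- Markov's inequality for the squared Frobenius distance.
  have hbad : P {ω | (k / 2 ^ S) ^ 2 ≤ f ω} ≤ ENNReal.ofReal δ := by
    have h := MeasureTheory.mul_meas_ge_le_integral_of_nonneg (Filter.Eventually.of_forall hf0)
      (hsample.integrable_fluctuation ho) ((k / 2 ^ S) ^ 2)
    have h' : P.real {ω | (k / 2 ^ S) ^ 2 ≤ f ω} ≤ δ := by
      refine le_of_mul_le_mul_left ?_ hε
      rw [mul_comm _ δ]
      exact h.trans hmean
    rw [← MeasureTheory.ofReal_measureReal]
    exact ENNReal.ofReal_le_ofReal h'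
  -- The set of the claim is not shown to be measurable, so the bound goes through a cover.
  have hcover : (1 : ENNReal) ≤ P {ω | (k / 2 ^ S) ^ 2 ≤ f ω} + P {ω | f ω < (k / 2 ^ S) ^ 2} := by
    rw [← MeasureTheory.measure_univ (μ := P)]
    refine (MeasureTheory.measure_mono fun ω _ => ?_).trans (MeasureTheory.measure_union_le _ _)
    exact (le_or_gt ((k / 2 ^ S) ^ 2) (f ω)).imp id id
  rw [ENNReal.ofReal_sub _ hδ.1.le, ENNReal.ofReal_one, tsub_le_iff_left]
  refine hcover.trans (add_le_add hbad (MeasureTheory.measure_mono fun ω hω lam hlam => ?_))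
  exact QNTK.eigenvalue_bounds_of_fluctuation_le hk hDpos hΔ hlow hup (le_of_lt hω) _
    (QNTK.jacobian_zero_eq_feature o (fun d => s d ω) (fun d => w d ω) (fun a n => x a n ω)) lam
    hlam
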